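/- Let $\Gamma$ be a countable (discrete) abelian group, and let $\alpha:\Gamma\to\Gamma$ be an injective homomorphism such that $N=[\Gamma:\alpha(\Gamma)]$ is finite, $N>1$, and $\bigcap_{n}\alpha^n(\Gamma)$ is trivial. Let $\alpha^*$ be the dual endomorphism of the compact group $\widehat\Gamma$, $[\alpha^*(\omega)](\gamma)=\omega(\alpha(\gamma))$, and let $\mu$ be normalized Haar measure on $\widehat\Gamma$. All pointwise identities are understood $\mu$-almost everywhere. **GMRAs.** A generalized multiresolution analysis (GMRA) in a separable Hilbert space $\mathcal H$, relative to a unitary representation $\pi$ of $\Gamma$ on $\mathcal H$ and a unitary $\delta$ on $\mathcal H$ with $\delta^{-1}\pi_\gamma\delta=\pi_{\alpha(\gamma)}$ for all $\gamma$, is a family $\{V_j\}_{j\in\mathbb Z}$ of closed subspaces with $V_j\subseteq V_{j+1}$, $V_{j+1}=\delta(V_j)$, $\bigcap_j V_j=\{0\}$, $\bigcup_j V_j$ dense, and $V_0$ invariant under $\pi$. GMRAs $\{V_j\}$ in $\mathcal H$ (relative to $\pi,\delta$) and $\{V'_j\}$ in $\mathcal H'$ (relative to $\pi',\delta'$) are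 equivalent if there is a unitary $U:\mathcal H\to\mathcal H'$ with $U(V_j)=V'_j$ for all $j$, $U\pi_\gamma=\pi'_\gamma U$ for all $\gamma$, and $U\delta=\delta'U$. **Multiplicity functions and filters.** A multiplicity function is a Borel function $m:\widehat\Gamma\to\{0,1,2,\dots\}$ with $m(\omega)\le\sum_{\alpha^*(\zeta)=\omega}m(\zeta)$. Put $\widetilde m(\omega)=\sum_{\alpha^*(\zeta)=\omega}m(\zeta)-m(\omega)$, $\sigma_i=\{m\ge i\}$ and $\widetilde\sigma_k=\{\widetilde m\ge k\}$ for $i,k\ge1$. A filter relative to $m$ and $\alpha^*$ is a matrix $H=[h_{i,j}]_{i,j\ge 1}$ of Borel functions $\widehat\Gamma\to\mathbb C$, $h_{i,j}$ supported in $\sigma_j$, with $$\sum_{\alpha^*(\zeta)=\omega}\sum_j h_{i,j}(\zeta)\overline{h_{i',j}(\zeta)}=N\delta_{i,i'}\chi_{\sigma_i}(\omega).$$ A filter complementary to $H$ is a matrix $G=[g_{k,j}]_{k,j\ge 1}$ of Borel functions, $g_{k,j}$ supported in $\sigma_j$, with $$\sum_{\alpha^*(\zeta)=\omega}\sum_j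 g_{k,j}(\zeta)\overline{g_{k',j}(\zeta)}=N\delta_{k,k'}\chi_{\widetilde\sigma_k}(\omega),\qquad \sum_{\alpha^*(\zeta)=\omega}\sum_j g_{k,j}(\zeta)\overline{h_{i,j}(\zeta)}=0.$$ The Ruelle operators are $[S_Hf](\omega)=H^t(\omega)f(\alpha^*(\omega))$ on $\bigoplus_iL^2(\sigma_i,\mu)$ and $[S_Gf](\omega)=G^t(\omega)f(\alpha^*(\omega))$ from $\bigoplus_kL^2(\widetilde\sigma_k,\mu)$ to $\bigoplus_iL^2(\sigma_i,\mu)$. An isometry $S$ is pure if $\bigcap_n \operatorname{ran}S^n=\{0\}$. **The canonical GMRA.** Let $c$ be a Borel cross section of $\alpha^*$ (a Borel map with $\alpha^*\circ c=\mathrm{id}$), and $\tau(\omega)=c(\alpha^*(\omega))\omega^{-1}\in\ker\alpha^*$. For a direct sum $\mathcal K=\bigoplus_iL^2(\nu_i)$ over finite Borel measures $\nu_i$ on $\widehat\Gamma$, let $\mathcal D\mathcal K=\bigoplus_{i,\,\zeta\in\ker\alpha^*}L^2(\nu'_{i,\zeta})$ with $\nu'_{i,\zeta}=N\,\alpha^*_*(\nu_i|_{\{\tau=\zeta\}})$,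 and let $\mathcal D:\mathcal K\to\mathcal D\mathcal K$ be the unitary $[\mathcal Df]_{i,\zeta}(\omega)=N^{-1/2}f_i(\zeta^{-1}c(\omega))$. Put $\mathcal V_0=\bigoplus_iL^2(\sigma_i,\mu)$, $\mathcal W_0=\bigoplus_kL^2(\widetilde\sigma_k,\mu)$, $\mathcal W_n=\mathcal D\mathcal W_{n-1}$ for $n\ge1$, and $\mathcal H=\mathcal V_0\oplus\bigoplus_{n\ge0}\mathcal W_n$, let $[\pi_\gamma f](\omega)=\omega(\gamma)f(\omega)$, and let $T$ be given by $(Tf)_{\mathcal V_0}=S_Hf_{\mathcal V_0}+S_Gf_{\mathcal W_0}$ and $(Tf)_{\mathcal W_n}=\mathcal D^{-1}f_{\mathcal W_{n+1}}$. The canonical GMRA $\{V_j^{m,H,G}\}$ is the family $V_j^{m,H,G}=T^{-j}(\mathcal V_0)$ in $\mathcal H$, relative to $\pi$ and $\delta=T^{-1}$. **Statement.** Let $m$ be a multiplicity function and $H$ a filter relative to $m$ and $\alpha^*$ for which $S_H$ is a pure isometry. Let $G$ and $G'$ be any two filters complementary to $H$. Then the families $\{V_j^{m,H,G}\}$ and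 $\{V_j^{m,H,G'}\}$, built with any Borel cross sections $c$ and $c'$ of $\alpha^*$ respectively, are well-defined GMRAs, and they are equivalent. Hence the equivalence class of the canonical GMRA depends only on $(m,H)$. -/

import Mathlib

open MeasureTheory TopologicalSpace
open scoped ENNReal ComplexConjugate

/-- The dual group `Γ^` carries its Borel σ-algebra. -/
noncomputable instance instMeasurableSpaceDual {Γ : Type*} [CommGroup Γ] [TopologicalSpace Γ] :
    MeasurableSpace (PontryaginDual Γ) := borel _

noncomputable instance instBorelSpaceDual {Γ : Type*} [CommGroup Γ] [TopologicalSpace Γ] :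
    BorelSpace (PontryaginDual Γ) := ⟨rfl⟩

noncomputable section

/-! ### Generalized multiresolution analyses -/

section GMRA

universe u v w

variable {Γ : Type u} [CommGroup Γ]

/-- A generalized multiresolution analysis in the Hilbert space `E`, together with the unitary
representation `π` of `Γ` and the unitary dilation `δ` that it is relative to. -/
structure GMRA (α : Γ →* Γ) (E : Type v) [NormedAddCommGroup E] [InnerProductSpace ℂ E]
    [CompleteSpace E] where
  separable : SeparableSpace E
  π : Γ →* (E ≃ₗᵢ[ℂ] E)
  δ : E ≃ₗᵢ[ℂ] E
  conj_eq : ∀ (γ : Γ) (x : E), δ.symm (π γ (δ x)) = π (α γ) x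
  V : ℤ → Submodule ℂ E
  isClosed : ∀ j, IsClosed (V j : Set E)
  le_succ : ∀ j, V j ≤ V (j + 1)
  map_eq : ∀ j, V (j + 1) = (V j).map (δ : E →ₗ[ℂ] E)
  iInf_eq : ⨅ j, V j = ⊥
  dense : Dense (⋃ j, (V j : Set E))
  invariant : ∀ γ, ∀ x ∈ V 0, π γ x ∈ V 0

/-- Two GMRAs are equivalent if a unitary operator carries one onto the other and intertwines
the representations and the dilations. -/
def GMRA.Equivalent {α : Γ →* Γ} {E : Type v} {F : Type w}
    [NormedAddCommGroup E] [InnerProductSpace ℂ E] [CompleteSpace E]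
    [NormedAddCommGroup F] [InnerProductSpace ℂ F] [CompleteSpace F]
    (X : GMRA α E) (Y : GMRA α F) : Prop :=
  ∃ U : E ≃ₗᵢ[ℂ] F,
    (∀ j, (X.V j).map (U : E →ₗ[ℂ] F) = Y.V j) ∧
    (∀ γ x, U (X.π γ x) = Y.π γ (U x)) ∧
    (∀ x, U (X.δ x) = Y.δ (U x))

/-- An isometry `S` is pure if `⋂ₙ Sⁿ(E) = {0}`. -/
def IsPureIsometry {E : Type v} [NormedAddCommGroup E] [InnerProductSpace ℂ E]
    (S : E →ₗᵢ[ℂ] E) : Prop :=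
  (⋂ n : ℕ, Set.range (S^[n])) = {0}

end GMRA

/-! ### Multiplicity functions and filters -/

section Filters

universe u

variable {Γ : Type u} [CommGroup Γ] [TopologicalSpace Γ] [DiscreteTopology Γ]

/-- Normalized Haar measure on the compact group `Γ^`. -/
def dualHaar (Γ : Type u) [CommGroup Γ] [TopologicalSpace Γ] [DiscreteTopology Γ] :
    Measure (PontryaginDual Γ) :=
  Measure.haarMeasure (⊤ : PositiveCompacts (PontryaginDual Γ))

/-- The dual endomorphism `α^*`, with `(α^* ω)(γ) = ω (α γ)`. -/
def dualEnd (α : Γ →* Γ) : PontryaginDual Γ →ₜ* PontryaginDual Γ :=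
  PontryaginDual.map ⟨α, continuous_of_discreteTopology⟩

/-- The sum of `f` over all `ζ` with `α^*(ζ) = ω`. -/
def fiberSum (α : Γ →* Γ) {M : Type*} [AddCommMonoid M] (f : PontryaginDual Γ → M)
    (ω : PontryaginDual Γ) : M :=
  ∑ᶠ (ζ : PontryaginDual Γ) (_ : dualEnd α ζ = ω), f ζ

/-- A multiplicity function: a Borel function with values in `{0, 1, 2, …}` that satisfies the
consistency inequality (almost everywhere). -/
structure IsMultiplicityFunction (α : Γ →* Γ) (m : PontryaginDual Γ → ℕ) : Prop where
  measurable : Measurable m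
  consistency : ∀ᵐ ω ∂(dualHaar Γ), m ω ≤ fiberSum α m ω

/-- The complementary multiplicity `m̃(ω) = ∑_{α^*(ζ) = ω} m(ζ) - m(ω)`; by the consistency
inequality the natural-number subtraction does not truncate, up to a null set. -/
def mTilde (α : Γ →* Γ) (m : PontryaginDual Γ → ℕ) (ω : PontryaginDual Γ) : ℕ :=
  fiberSum α m ω - m ω

/-- The set `σ_{i+1} = {ω : m(ω) ≥ i + 1}`. Rows and columns are numbered from `0` throughout. -/
def levelSet (m : PontryaginDual Γ → ℕ) (i : ℕ) : Set (PontryaginDual Γ) :=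
  {ω | i + 1 ≤ m ω}

/-- `H = [h_{i,j}]` is a filter relative to `m` and `α^*`. Because `h_{i,j}` is supported in `σ_j`
and `m` is finite, the sums over `j` have finitely many nonzero terms. -/
structure IsFilterRel (α : Γ →* Γ) (m : PontryaginDual Γ → ℕ)
    (H : ℕ → ℕ → PontryaginDual Γ → ℂ) : Prop where
  measurable : ∀ i j, Measurable (H i j)
  support : ∀ i j, ∀ᵐ ω ∂(dualHaar Γ), ω ∉ levelSet m j → H i j ω = 0
  filter_eq : ∀ i i', ∀ᵐ ω ∂(dualHaar Γ),
    fiberSum α (fun ζ => ∑' j, H i j ζ * conj (H i' j ζ)) ω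
      = if i = i' then (levelSet m i).indicator (fun _ => (α.range.index : ℂ)) ω else 0

/-- `G = [g_{k,j}]` is a complementary filter to the filter `H`. -/
structure IsComplementaryFilter (α : Γ →* Γ) (m : PontryaginDual Γ → ℕ)
    (H G : ℕ → ℕ → PontryaginDual Γ → ℂ) : Prop where
  measurable : ∀ k j, Measurable (G k j)
  support : ∀ k j, ∀ᵐ ω ∂(dualHaar Γ), ω ∉ levelSet m j → G k j ω = 0
  filter_eq : ∀ k k', ∀ᵐ ω ∂(dualHaar Γ),
    fiberSum α (fun ζ => ∑' j, G k j ζ * conj (G k' j ζ)) ω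
      = if k = k' then (levelSet (mTilde α m) k).indicator (fun _ => (α.range.index : ℂ)) ω else 0
  orthogonal : ∀ k i, ∀ᵐ ω ∂(dualHaar Γ),
    fiberSum α (fun ζ => ∑' j, G k j ζ * conj (H i j ζ)) ω = 0

/-- The pointwise formula `ω ↦ Fᵗ(ω) f(α^*(ω))` for the Ruelle operator of a matrix `F`. -/
def ruelle (α : Γ →* Γ) (F : ℕ → ℕ → PontryaginDual Γ → ℂ) (f : ℕ → PontryaginDual Γ → ℂ)
    (j : ℕ) (ω : PontryaginDual Γ) : ℂ :=
  ∑' i, F i j ω * f i (dualEnd α ω)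

/-- The Hilbert space `⨁ᵢ L²(σ_i)`. -/
abbrev CoreSpace (m : PontryaginDual Γ → ℕ) : Type u :=
  lp (fun i : ℕ => Lp ℂ 2 ((dualHaar Γ).restrict (levelSet m i))) 2

/-- `f ↦ Hᵗ(ω) f(α^*(ω))` defines an isometry `S_H` of `⨁ᵢ L²(σ_i)`, and this isometry is pure. -/
def RuelleIsPureIsometry (α : Γ →* Γ) (m : PontryaginDual Γ → ℕ)
    (H : ℕ → ℕ → PontryaginDual Γ → ℂ) : Prop :=
  ∃ S : CoreSpace m →ₗᵢ[ℂ] CoreSpace m,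
    (∀ (f : CoreSpace m) (j : ℕ),
      S f j =ᵐ[(dualHaar Γ).restrict (levelSet m j)] ruelle α H (fun i => f i) j) ∧
    IsPureIsometry S

/-! ### The canonical GMRA -/

/-- A Borel cross section `c` of `α^*`. -/
structure IsBorelCrossSection (α : Γ →* Γ) (c : PontryaginDual Γ → PontryaginDual Γ) : Prop where
  measurable : Measurable c
  section_eq : ∀ ω, dualEnd α (c ω) = ω

/-- The kernel of `α^*`. -/
abbrev DualKer (α : Γ →* Γ) : Type u := (dualEnd α : PontryaginDual Γ →* PontryaginDual Γ).ker

/-- The set on which `τ(ω) = c(α^*(ω)) ω⁻¹` takes the value `ζ`. -/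
def tauSet (α : Γ →* Γ) (c : PontryaginDual Γ → PontryaginDual Γ) (ζ : DualKer α) :
    Set (PontryaginDual Γ) :=
  {ω | c (dualEnd α ω) * ω⁻¹ = ζ}

/-- The measures of the `L²` spaces of which `𝒲₀ = ⨁ₖ L²(σ̃_k)` and its successive dilates
`𝒲ₙ = 𝒟(𝒲ₙ₋₁)` are the direct sums. The summands of `𝒲ₙ` are indexed by `k` and a word
of length `n` in the kernel of `α^*`. If `ν` (living on the set `E`) belongs to a summand of
`𝒲ₙ`, then the dilate has the summands `N α^*_*(ν|_{E_ζ})`, where `E_ζ = {ω ∈ E : τ(ω) = ζ}`. -/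
def wMeasure (α : Γ →* Γ) (c : PontryaginDual Γ → PontryaginDual Γ) (m : PontryaginDual Γ → ℕ)
    (k : ℕ) : List (DualKer α) → Measure (PontryaginDual Γ)
  | [] => (dualHaar Γ).restrict (levelSet (mTilde α m) k)
  | ζ :: l => (α.range.index : ℝ≥0∞) •
      ((wMeasure α c m k l).restrict (tauSet α c ζ)).map (dualEnd α)

/-- The measures of all the `L²` summands of `𝒱₀ ⊕ ⨁ₙ 𝒲ₙ`: the index `inl i` stands for
the summand `L²(σ_i)` of `𝒱₀`, and `inr (k, l)` for a summand of `𝒲ₙ`, `n` the length of `l`. -/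
def canonicalMeasure (α : Γ →* Γ) (c : PontryaginDual Γ → PontryaginDual Γ)
    (m : PontryaginDual Γ → ℕ) : ℕ ⊕ (ℕ × List (DualKer α)) → Measure (PontryaginDual Γ)
  | Sum.inl i => (dualHaar Γ).restrict (levelSet m i)
  | Sum.inr (k, l) => wMeasure α c m k l

/-- The Hilbert space `𝒱₀ ⊕ ⨁ₙ 𝒲ₙ`, as the Hilbert sum of all its `L²` summands. -/
abbrev CanonicalSpace (α : Γ →* Γ) (c : PontryaginDual Γ → PontryaginDual Γ)
    (m : PontryaginDual Γ → ℕ) : Type u :=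
  lp (fun a : ℕ ⊕ (ℕ × List (DualKer α)) => Lp ℂ 2 (canonicalMeasure α c m a)) 2

/-- The subspace `𝒱₀` of `𝒱₀ ⊕ ⨁ₙ 𝒲ₙ`. -/
def coreSubspace (α : Γ →* Γ) (c : PontryaginDual Γ → PontryaginDual Γ)
    (m : PontryaginDual Γ → ℕ) : Submodule ℂ (CanonicalSpace α c m) where
  carrier := {f | ∀ p, f (Sum.inr p) = 0}
  zero_mem' := by
    intro p
    rfl
  add_mem' := by
    intro f g hf hg p
    have h1 := hf p
    have h2 := hg p
    simp [h1, h2]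
  smul_mem' := by
    intro a f hf p
    have h1 := hf p
    simp [h1]

/-- The pointwise formula `ω ↦ N^{-1/2} f(ζ⁻¹ c(ω))` for the component with index `ζ` of the
positive dilate `𝒟 f`. -/
def dilate (α : Γ →* Γ) (c : PontryaginDual Γ → PontryaginDual Γ)
    (f : PontryaginDual Γ → ℂ) (ζ : DualKer α) (ω : PontryaginDual Γ) : ℂ :=
  (1 / (Real.sqrt (α.range.index : ℝ) : ℂ)) * f ((ζ : PontryaginDual Γ)⁻¹ * c ω)

/-- `X` is the canonical GMRA `{V_j^{m,H,G}}`: `Γ` acts by multiplication by characters; the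
inverse dilation `T = δ⁻¹` satisfies `(T f)_{𝒱₀} = S_H f_{𝒱₀} + S_G f_{𝒲₀}` and
`(T f)_{𝒲ₙ} = 𝒟⁻¹ f_{𝒲ₙ₊₁}`, that is, `𝒟 (T f)_{𝒲ₙ} = f_{𝒲ₙ₊₁}`; and
`V_j = T^{-j}(𝒱₀)`. These conditions determine `X`. -/
structure IsCanonicalGMRA (α : Γ →* Γ) (c : PontryaginDual Γ → PontryaginDual Γ)
    (m : PontryaginDual Γ → ℕ) (H G : ℕ → ℕ → PontryaginDual Γ → ℂ)
    (X : GMRA α (CanonicalSpace α c m)) : Prop where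
  rep_eq : ∀ (γ : Γ) (f : CanonicalSpace α c m) (a),
    X.π γ f a =ᵐ[canonicalMeasure α c m a] fun ω => (ω γ : ℂ) * f a ω
  core_eq : ∀ (f : CanonicalSpace α c m) (j : ℕ),
    X.δ.symm f (Sum.inl j) =ᵐ[canonicalMeasure α c m (Sum.inl j)] fun ω =>
      ruelle α H (fun i => f (Sum.inl i)) j ω + ruelle α G (fun k => f (Sum.inr (k, []))) j ω
  dilate_eq : ∀ (f : CanonicalSpace α c m) (k : ℕ) (l : List (DualKer α)) (ζ : DualKer α),
    f (Sum.inr (k, ζ :: l)) =ᵐ[canonicalMeasure α c m (Sum.inr (k, ζ :: l))]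
      dilate α c (X.δ.symm f (Sum.inr (k, l))) ζ
  V_eq : ∀ j : ℤ, X.V j =
    (coreSubspace α c m).map
      ((X.δ ^ j : CanonicalSpace α c m ≃ₗᵢ[ℂ] CanonicalSpace α c m) :
        CanonicalSpace α c m →ₗ[ℂ] CanonicalSpace α c m)

end Filters

end

/-! The complementary filter and the cross section matter for the construction of the GMRA, but not
for its equivalence class.

Construction. Over almost every `ω`, put the rows of `H` with index below `m ω` and the rows of `G`
with index below `m̃ ω` into one matrix `M`, whose columns are the pairs of a point `ζ` of the fibre
and an index below `m ζ`. The filter equations say `M Mᴴ = N`. Since `m + m̃` is the fibre sum of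
`m`, the matrix is square, so also `Mᴴ M = N`. As `α^*` preserves Haar measure and its kernel has
`N` elements, the first identity makes `T` isometric from `𝒱₀ ⊕ 𝒲₀` to `𝒱₀` and the second makes it
onto; on the remaining summands `T` is `𝒟⁻¹`. Hence `T` is unitary (`l2Energy_invDilation`,
`ae_invDilation_forwardDilation`, `exists_invDilation_unitary`). Its restriction to `𝒱₀` is `S_H`,
so purity gives `⋂ V_j = 0`. Since `T` moves `𝒲ₙ₊₁` to `𝒲ₙ` and `𝒲₀` into `𝒱₀`, every vector with
finitely many nonzero components lies in some `V_n`, which gives density.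

Equivalence. On `𝒱₀` neither `G` nor `c` is visible: `T` is `S_H` and `π` is multiplication by
characters. The vectors `δⁿ v` with `v ∈ 𝒱₀` are dense, and `δⁿ v ↦ δ'ⁿ v` preserves norms. It is a
consistent linear relation because `δⁿ v = δⁿ⁺ᵏ S_Hᵏ v`, so it extends to a unitary. That unitary
intertwines the dilations by construction and the representations because `π_γ δⁿ = δⁿ π_{αⁿγ}`
(`GMRA.equivalent_of_core`). -/

/-! ### Hilbert sums of `L²` spaces -/

section HilbertSum

variable {X ι κ : Type*} [MeasurableSpace X]

/-- The sum of the squared `L²` seminorms of a family of functions. -/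
noncomputable def l2Energy (ν : ι → Measure X) (f : ι → X → ℂ) : ℝ≥0∞ :=
  ∑' a, ∫⁻ ω, ‖f a ω‖ₑ ^ 2 ∂ν a

theorem l2Energy_congr {ν : ι → Measure X} {f g : ι → X → ℂ} (h : ∀ a, f a =ᵐ[ν a] g a) :
    l2Energy ν f = l2Energy ν g := by
  refine tsum_congr fun a => lintegral_congr_ae ?_
  filter_upwards [h a] with ω hω
  rw [hω]

theorem ae_eq_zero_of_l2Energy_eq_zero {ν : ι → Measure X} {f : ι → X → ℂ}
    (hf : ∀ a, Measurable (f a)) (h : l2Energy ν f = 0) (a : ι) : f a =ᵐ[ν a] 0 := by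
  have h1 := ENNReal.tsum_eq_zero.1 h a
  rw [lintegral_eq_zero_iff ((hf a).enorm.pow_const 2)] at h1
  filter_upwards [h1] with ω hω
  simpa using hω

theorem enorm_sq_eq_lintegral {ν : Measure X} (f : Lp ℂ 2 ν) :
    ‖f‖ₑ ^ 2 = ∫⁻ ω, ‖f ω‖ₑ ^ 2 ∂ν := by
  have h := eLpNorm_nnreal_pow_eq_lintegral (f := f) (μ := ν) (p := 2) (by norm_num)
  rw [Lp.enorm_def]
  simpa using h

theorem ofReal_norm_sq_eq_l2Energy {ν : ι → Measure X}
    (f : lp (fun a => Lp ℂ 2 (ν a)) 2) :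
    ENNReal.ofReal (‖f‖ ^ 2) = l2Energy ν (fun a => f a) := by
  have h := lp.hasSum_norm (p := 2) (by norm_num) f
  simp only [ENNReal.toReal_ofNat, Real.rpow_ofNat] at h
  rw [← h.tsum_eq, ENNReal.ofReal_tsum_of_nonneg (fun _ => by positivity) h.summable]
  refine tsum_congr fun a => ?_
  rw [← enorm_sq_eq_lintegral, ENNReal.ofReal_pow (norm_nonneg _), ofReal_norm]

theorem l2Energy_coe_ne_top {ν : ι → Measure X} (f : lp (fun a => Lp ℂ 2 (ν a)) 2) :
    l2Energy ν (fun a => f a) ≠ ∞ := by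
  rw [← ofReal_norm_sq_eq_l2Energy]
  exact ENNReal.ofReal_ne_top

theorem norm_eq_of_l2Energy_eq {ν : ι → Measure X} {ρ : κ → Measure X}
    (f : lp (fun a => Lp ℂ 2 (ν a)) 2) (g : lp (fun b => Lp ℂ 2 (ρ b)) 2)
    (h : l2Energy ν (fun a => f a) = l2Energy ρ (fun b => g b)) : ‖f‖ = ‖g‖ := by
  rw [← ofReal_norm_sq_eq_l2Energy, ← ofReal_norm_sq_eq_l2Energy,
    ENNReal.ofReal_eq_ofReal_iff (by positivity) (by positivity)] at h
  exact (sq_eq_sq₀ (norm_nonneg _) (norm_nonneg _)).1 h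

theorem measurable_coe_lp {ν : ι → Measure X} (f : lp (fun a => Lp ℂ 2 (ν a)) 2) (a : ι) :
    Measurable (f a) :=
  (Lp.stronglyMeasurable (f a)).measurable

theorem lp_ext_ae {ν : ι → Measure X} {f g : lp (fun a => Lp ℂ 2 (ν a)) 2}
    (h : ∀ a, f a =ᵐ[ν a] g a) : f = g :=
  lp.ext (funext fun a => Lp.ext (h a))

theorem coe_lp_add {ν : ι → Measure X} (f g : lp (fun a => Lp ℂ 2 (ν a)) 2) (a : ι) :
    ((f + g) a : X → ℂ) =ᵐ[ν a] (f a : X → ℂ) + g a :=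
  Lp.coeFn_add (f a) (g a)

theorem coe_lp_smul {ν : ι → Measure X} (z : ℂ) (f : lp (fun a => Lp ℂ 2 (ν a)) 2) (a : ι) :
    ((z • f) a : X → ℂ) =ᵐ[ν a] z • (f a : X → ℂ) :=
  Lp.coeFn_smul z (f a)

/-- A measurable family of finite energy represents an element of the Hilbert sum. -/
theorem exists_lp_of_l2Energy_ne_top {ν : ι → Measure X} {f : ι → X → ℂ}
    (hf : ∀ a, Measurable (f a)) (h : l2Energy ν f ≠ ∞) :
    ∃ F : lp (fun a => Lp ℂ 2 (ν a)) 2, ∀ a, F a =ᵐ[ν a] f a := by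
  have hfin : ∀ a, ∫⁻ ω, ‖f a ω‖ₑ ^ 2 ∂ν a ≠ ∞ := fun a => ENNReal.ne_top_of_tsum_ne_top h a
  have hmem : ∀ a, MemLp (f a) 2 (ν a) := fun a => by
    refine ⟨(hf a).aestronglyMeasurable, ?_⟩
    have h1 := eLpNorm_nnreal_pow_eq_lintegral (f := f a) (μ := ν a) (p := 2) (by norm_num)
    have h2 : eLpNorm (f a) 2 (ν a) ^ 2 = ∫⁻ ω, ‖f a ω‖ₑ ^ 2 ∂ν a := by simpa using h1
    refine lt_top_iff_ne_top.2 fun h3 => hfin a ?_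
    rw [← h2, h3]
    simp
  have hsq : ∀ a, ENNReal.ofReal (‖(hmem a).toLp (f a)‖ ^ 2) = ∫⁻ ω, ‖f a ω‖ₑ ^ 2 ∂ν a :=
    fun a => by
      rw [ENNReal.ofReal_pow (norm_nonneg _), ofReal_norm, enorm_sq_eq_lintegral]
      refine lintegral_congr_ae ?_
      filter_upwards [(hmem a).coeFn_toLp] with ω hω
      rw [hω]
  have hsum : Memℓp (fun a => (hmem a).toLp (f a)) 2 := by
    refine memℓp_gen ?_
    simp only [ENNReal.toReal_ofNat, Real.rpow_ofNat]
    have h1 := ENNReal.summable_toReal h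
    refine h1.congr fun a => ?_
    rw [← hsq, ENNReal.toReal_ofReal (by positivity)]
  exact ⟨⟨_, hsum⟩, fun a => (hmem a).coeFn_toLp⟩

/-! ### Operators defined by pointwise formulas -/

section Operator

variable {ν : ι → Measure X} {ρ : κ → Measure X}
  {P : (ι → X → ℂ) →ₗ[ℂ] (κ → X → ℂ)}

/-- By linearity the difference of the images is the image of a family of zero energy. This makes a
pointwise formula independent of the chosen representatives. -/
theorem ae_eq_of_l2Energy_preserving
    (hmeas : ∀ f, (∀ a, Measurable (f a)) → ∀ b, Measurable (P f b))
    (henergy : ∀ f, (∀ a, Measurable (f a)) → l2Energy ρ (P f) = l2Energy ν f)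
    {f g : ι → X → ℂ} (hf : ∀ a, Measurable (f a)) (hg : ∀ a, Measurable (g a))
    (h : ∀ a, f a =ᵐ[ν a] g a) (b : κ) : P f b =ᵐ[ρ b] P g b := by
  have hd : ∀ a, Measurable ((f - g) a) := fun a => (hf a).sub (hg a)
  have h0 : l2Energy ρ (P (f - g)) = 0 := by
    rw [henergy _ hd, l2Energy_congr (g := 0)]
    · simp [l2Energy]
    · intro a
      filter_upwards [h a] with ω hω
      simp [hω]
  filter_upwards [ae_eq_zero_of_l2Energy_eq_zero (hmeas _ hd) h0 b] with ω hω
  simpa [map_sub, sub_eq_zero] using hω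

/-- A pointwise defined linear transformation of families of functions that preserves energy
defines an isometry of Hilbert sums. -/
theorem exists_isometry_of_l2Energy_preserving
    (hmeas : ∀ f, (∀ a, Measurable (f a)) → ∀ b, Measurable (P f b))
    (henergy : ∀ f, (∀ a, Measurable (f a)) → l2Energy ρ (P f) = l2Energy ν f) :
    ∃ T : lp (fun a => Lp ℂ 2 (ν a)) 2 →ₗᵢ[ℂ] lp (fun b => Lp ℂ 2 (ρ b)) 2,
      ∀ (F : lp (fun a => Lp ℂ 2 (ν a)) 2) (f : ι → X → ℂ), (∀ a, Measurable (f a)) →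
        (∀ a, F a =ᵐ[ν a] f a) → ∀ b, T F b =ᵐ[ρ b] P f b := by
  have hex : ∀ F : lp (fun a => Lp ℂ 2 (ν a)) 2, ∃ T : lp (fun b => Lp ℂ 2 (ρ b)) 2,
      ∀ b, T b =ᵐ[ρ b] P (fun a => F a) b := fun F =>
    exists_lp_of_l2Energy_ne_top (hmeas _ (measurable_coe_lp F)) (by
      rw [henergy _ (measurable_coe_lp F)]; exact l2Energy_coe_ne_top F)
  choose T hT using hex
  have hT' : ∀ (F : lp (fun a => Lp ℂ 2 (ν a)) 2) (f : ι → X → ℂ), (∀ a, Measurable (f a)) →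
        (∀ a, F a =ᵐ[ν a] f a) → ∀ b, T F b =ᵐ[ρ b] P f b := fun F f hf h b =>
    (hT F b).trans (ae_eq_of_l2Energy_preserving hmeas henergy (measurable_coe_lp F) hf h b)
  refine ⟨⟨⟨⟨T, fun F G => ?_⟩, fun z F => ?_⟩, fun F => ?_⟩, hT'⟩
  · refine lp_ext_ae fun b => ?_
    have h1 := hT' (F + G) ((fun a => (F a : X → ℂ)) + fun a => (G a : X → ℂ))
      (fun a => (measurable_coe_lp F a).add (measurable_coe_lp G a)) (coe_lp_add F G) b
    filter_upwards [h1, hT F b, hT G b, coe_lp_add (T F) (T G) b] with ω h1 h2 h3 h4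
    rw [h1, h4, map_add]
    simp [h2, h3]
  · refine lp_ext_ae fun b => ?_
    have h1 := hT' (z • F) (z • fun a => (F a : X → ℂ))
      (fun a => (measurable_coe_lp F a).const_smul z) (coe_lp_smul z F) b
    filter_upwards [h1, hT F b, coe_lp_smul z (T F) b] with ω h1 h2 h4
    rw [h1, RingHom.id_apply, h4, map_smul]
    simp [h2]
  · refine norm_eq_of_l2Energy_eq _ _ ?_
    rw [← henergy _ (measurable_coe_lp F)]
    exact l2Energy_congr (hT F)

/-- If the transformation has a pointwise right inverse, then it defines a unitary. -/
theorem exists_unitary_of_l2Energy_preserving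
    (hmeas : ∀ f, (∀ a, Measurable (f a)) → ∀ b, Measurable (P f b))
    (henergy : ∀ f, (∀ a, Measurable (f a)) → l2Energy ρ (P f) = l2Energy ν f)
    (hsurj : ∀ g : κ → X → ℂ, (∀ b, Measurable (g b)) →
      ∃ f : ι → X → ℂ, (∀ a, Measurable (f a)) ∧ ∀ b, P f b =ᵐ[ρ b] g b) :
    ∃ T : lp (fun a => Lp ℂ 2 (ν a)) 2 ≃ₗᵢ[ℂ] lp (fun b => Lp ℂ 2 (ρ b)) 2,
      ∀ (F : lp (fun a => Lp ℂ 2 (ν a)) 2) (f : ι → X → ℂ), (∀ a, Measurable (f a)) →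
        (∀ a, F a =ᵐ[ν a] f a) → ∀ b, T F b =ᵐ[ρ b] P f b := by
  obtain ⟨T, hT⟩ := exists_isometry_of_l2Energy_preserving hmeas henergy
  refine ⟨LinearIsometryEquiv.ofSurjective T fun G => ?_, hT⟩
  obtain ⟨f, hf, hPf⟩ := hsurj (fun b => G b) (measurable_coe_lp G)
  -- The pointwise preimage has the same energy as `G`, so it is square integrable.
  obtain ⟨F, hF⟩ := exists_lp_of_l2Energy_ne_top (ν := ν) hf (by
    rw [← henergy f hf, l2Energy_congr hPf]
    exact l2Energy_coe_ne_top G)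
  exact ⟨F, lp_ext_ae fun b => (hT F f hf hF b).trans (hPf b)⟩

end Operator

/-- A Hilbert sum of countably many separable spaces is separable. -/
theorem separableSpace_lp {ι : Type*} [Countable ι] {E : ι → Type*}
    [∀ i, NormedAddCommGroup (E i)] [∀ i, NormedSpace ℂ (E i)] [∀ i, SeparableSpace (E i)] :
    SeparableSpace (lp E 2) := by
  classical
  have h1 : IsSeparable (⋃ i, Set.range (lp.single 2 i : E i → lp E 2)) :=
    .iUnion fun i => isSeparable_range (lp.isometry_single i).continuous
  have h2 := (h1.span (R := ℂ)).closure
  refine isSeparable_univ_iff.1 (h2.mono fun f _ => ?_)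
  refine mem_closure_of_tendsto (lp.hasSum_single (by norm_num) f) (.of_forall fun s => ?_)
  exact Submodule.sum_mem _ fun i _ =>
    Submodule.subset_span (Set.mem_iUnion.2 ⟨i, Set.mem_range_self _⟩)

end HilbertSum

/-! ### Unitary operators from isometric relations -/

section Graph

variable {E F : Type*} [NormedAddCommGroup E] [InnerProductSpace ℂ E] [CompleteSpace E]
  [NormedAddCommGroup F] [InnerProductSpace ℂ F] [CompleteSpace F]

/-- A linear relation that preserves norms and has dense projections extends to a unitary. -/
theorem exists_unitary_of_norm_preserving_relation (R : Submodule ℂ (E × F))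
    (hR : ∀ p ∈ R, ‖p.1‖ = ‖p.2‖) (h₁ : Dense (Prod.fst '' (R : Set (E × F))))
    (h₂ : Dense (Prod.snd '' (R : Set (E × F)))) :
    ∃ U : E ≃ₗᵢ[ℂ] F, ∀ p ∈ R, U p.1 = p.2 := by
  have hC : ∀ p ∈ R.topologicalClosure, ‖p.1‖ = ‖p.2‖ := fun p hp =>
    closure_minimal (t := {p : E × F | ‖p.1‖ = ‖p.2‖}) hR
      (isClosed_eq continuous_fst.norm continuous_snd.norm) hp
  have hle : ∀ p ∈ R, p ∈ R.topologicalClosure := fun p hp => R.le_topologicalClosure hp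
  have : CompleteSpace R.topologicalClosure :=
    R.isClosed_topologicalClosure.completeSpace_coe
  -- The product carries the maximum norm. On pairs with coordinates of equal norm it is the norm of
  -- either coordinate, so both projections are isometries with closed, dense range.
  let p₁ : R.topologicalClosure →ₗᵢ[ℂ] E :=
    ⟨(LinearMap.fst ℂ E F).comp R.topologicalClosure.subtype, fun p => by
      change ‖(p : E × F).1‖ = max ‖(p : E × F).1‖ ‖(p : E × F).2‖
      rw [← hC p p.2, max_self]⟩
  let p₂ : R.topologicalClosure →ₗᵢ[ℂ] F :=
    ⟨(LinearMap.snd ℂ E F).comp R.topologicalClosure.subtype, fun p => by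
      change ‖(p : E × F).2‖ = max ‖(p : E × F).1‖ ‖(p : E × F).2‖
      rw [hC p p.2, max_self]⟩
  have hs₁ : Function.Surjective p₁ := by
    rw [← Set.range_eq_univ, ← p₁.isometry.isClosedEmbedding.isClosed_range.closure_eq]
    refine (h₁.mono ?_).closure_eq
    rintro _ ⟨p, hp, rfl⟩
    exact ⟨⟨p, hle p hp⟩, rfl⟩
  have hs₂ : Function.Surjective p₂ := by
    rw [← Set.range_eq_univ, ← p₂.isometry.isClosedEmbedding.isClosed_range.closure_eq]
    refine (h₂.mono ?_).closure_eq
    rintro _ ⟨p, hp, rfl⟩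
    exact ⟨⟨p, hle p hp⟩, rfl⟩
  refine ⟨(LinearIsometryEquiv.ofSurjective p₁ hs₁).symm.trans
    (LinearIsometryEquiv.ofSurjective p₂ hs₂), fun p hp => ?_⟩
  have h : (LinearIsometryEquiv.ofSurjective p₁ hs₁).symm p.1 = ⟨p, hle p hp⟩ := by
    rw [LinearIsometryEquiv.symm_apply_eq]
    rfl
  rw [LinearIsometryEquiv.trans_apply, h]
  rfl

end Graph

/-! ### The dual endomorphism and its fibres -/

section Dual

universe u

variable {Γ : Type u} [CommGroup Γ] [TopologicalSpace Γ] [DiscreteTopology Γ]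

theorem secondCountableTopology_dual [Countable Γ] :
    SecondCountableTopology (PontryaginDual Γ) := by
  have h : Topology.IsClosedEmbedding ((⇑) : (Γ →ₜ* Circle) → Γ → Circle) :=
    ContinuousMonoidHom.isClosedEmbedding_coe
  exact h.isEmbedding.secondCountableTopology

instance instIsHaarMeasureDualHaar : (dualHaar Γ).IsHaarMeasure := by
  unfold dualHaar
  infer_instance

instance instIsProbabilityMeasureDualHaar : IsProbabilityMeasure (dualHaar Γ) :=
  ⟨Measure.haarMeasure_self (K₀ := (⊤ : PositiveCompacts (PontryaginDual Γ)))⟩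

theorem measurable_dualEnd (α : Γ →* Γ) : Measurable (dualEnd α) :=
  (dualEnd α).continuous_toFun.measurable

/-- A continuous surjective homomorphism of compact groups carries Haar measure to Haar measure of
the same total mass. Surjectivity will come from the cross section. -/
theorem measurePreserving_dualEnd {α : Γ →* Γ} (h : Function.Surjective (dualEnd α)) :
    MeasurePreserving (dualEnd α) (dualHaar Γ) (dualHaar Γ) :=
  (dualEnd α : PontryaginDual Γ →* PontryaginDual Γ).measurePreserving
    (dualEnd α).continuous_toFun h rfl

theorem mem_ker_dualEnd_iff (α : Γ →* Γ) (ω : PontryaginDual Γ) :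
    ω ∈ (dualEnd α : PontryaginDual Γ →* PontryaginDual Γ).ker ↔ ∀ γ, ω (α γ) = 1 := by
  rw [MonoidHom.mem_ker]
  constructor
  · intro h γ
    exact congrArg (fun χ : PontryaginDual Γ => χ γ) h
  · intro h
    exact PontryaginDual.ext h

/-- The kernel of the dual endomorphism is the dual group of the cokernel. -/
noncomputable def dualKerEquiv (α : Γ →* Γ) : DualKer α ≃ (Γ ⧸ α.range →* Circle) where
  toFun ω := QuotientGroup.lift α.range
    ((ω : PontryaginDual Γ) : Γ →* Circle) (by
      rintro _ ⟨γ, rfl⟩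
      exact (mem_ker_dualEnd_iff α ω).1 ω.2 γ)
  invFun χ := ⟨(⟨χ.comp (QuotientGroup.mk' α.range), continuous_of_discreteTopology⟩ :
    Γ →ₜ* Circle), (mem_ker_dualEnd_iff α _).2 fun γ => by
      change χ (QuotientGroup.mk (α γ)) = 1
      rw [(QuotientGroup.eq_one_iff (α γ)).2 (show α γ ∈ α.range from ⟨γ, rfl⟩), map_one]⟩
  left_inv ω := rfl
  right_inv χ := by
    ext γ
    rfl

/-- A finite abelian group has as many characters as elements, and the kernel is the character group
of `Γ ⧸ α(Γ)`. -/
theorem card_dualKer {α : Γ →* Γ} (h : α.range.index ≠ 0) :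
    Nat.card (DualKer α) = α.range.index := by
  have : Finite (Γ ⧸ α.range) := Nat.finite_of_card_ne_zero h
  rw [Nat.card_congr (dualKerEquiv α), Nat.card_congr
    ((toUnits (G := Circle)).monoidHomCongrRight (M := Γ ⧸ α.range)).toEquiv,
    CommGroup.card_monoidHom_of_hasEnoughRootsOfUnity (Γ ⧸ α.range) Circle]
  rfl

theorem finite_dualKer {α : Γ →* Γ} (h : α.range.index ≠ 0) : Finite (DualKer α) :=
  Nat.finite_of_card_ne_zero (by rwa [card_dualKer h])

/-! ### Cross sections and the indexing of fibres by the kernel -/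

section Section

variable {α : Γ →* Γ} {c : PontryaginDual Γ → PontryaginDual Γ}

theorem IsBorelCrossSection.surjective (hc : IsBorelCrossSection α c) :
    Function.Surjective (dualEnd α) := fun ω => ⟨c ω, hc.section_eq ω⟩

/-- The point of the fibre over `ω` with index `κ` in the kernel. -/
noncomputable def fiberPoint (c : PontryaginDual Γ → PontryaginDual Γ) (κ : DualKer α)
    (ω : PontryaginDual Γ) : PontryaginDual Γ :=
  (κ : PontryaginDual Γ)⁻¹ * c ω

theorem measurable_fiberPoint (hc : IsBorelCrossSection α c) (κ : DualKer α) :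
    Measurable (fiberPoint c κ) :=
  hc.measurable.const_mul _

theorem dualEnd_coe_ker (κ : DualKer α) : dualEnd α (κ : PontryaginDual Γ) = 1 := κ.2

theorem dualEnd_fiberPoint (hc : IsBorelCrossSection α c) (κ : DualKer α)
    (ω : PontryaginDual Γ) : dualEnd α (fiberPoint c κ ω) = ω := by
  rw [fiberPoint, map_mul, map_inv, dualEnd_coe_ker, hc.section_eq, inv_one, one_mul]

/-- The kernel element `τ(ω) = c(α^*(ω)) ω⁻¹`. -/
noncomputable def kerPart (hc : IsBorelCrossSection α c) (ω : PontryaginDual Γ) : DualKer α :=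
  ⟨c (dualEnd α ω) * ω⁻¹, by
    change dualEnd α _ = 1
    rw [map_mul, map_inv, hc.section_eq, mul_inv_cancel]⟩

theorem fiberPoint_kerPart (hc : IsBorelCrossSection α c) (ω : PontryaginDual Γ) :
    fiberPoint c (kerPart hc ω) (dualEnd α ω) = ω := by
  simp [fiberPoint, kerPart]

theorem mem_tauSet_iff (hc : IsBorelCrossSection α c) (κ : DualKer α) (ω : PontryaginDual Γ) :
    ω ∈ tauSet α c κ ↔ kerPart hc ω = κ := by
  rw [Subtype.ext_iff]
  rfl

theorem fiberPoint_of_mem_tauSet (hc : IsBorelCrossSection α c) {κ : DualKer α}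
    {ω : PontryaginDual Γ} (h : ω ∈ tauSet α c κ) : fiberPoint c κ (dualEnd α ω) = ω := by
  rw [← (mem_tauSet_iff hc κ ω).1 h, fiberPoint_kerPart]

theorem measurableSet_tauSet [Countable Γ] (hc : IsBorelCrossSection α c) (κ : DualKer α) :
    MeasurableSet (tauSet α c κ) := by
  have := secondCountableTopology_dual (Γ := Γ)
  exact measurableSet_eq_fun
    ((hc.measurable.comp (measurable_dualEnd α)).mul measurable_inv) measurable_const

theorem fiberPoint_injective (ω : PontryaginDual Γ) :
    Function.Injective fun κ : DualKer α => fiberPoint c κ ω := fun κ κ' h => by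
  simpa [fiberPoint] using h

theorem range_fiberPoint (hc : IsBorelCrossSection α c) (ω : PontryaginDual Γ) :
    Set.range (fun κ : DualKer α => fiberPoint c κ ω) = {ζ | dualEnd α ζ = ω} := by
  ext ζ
  constructor
  · rintro ⟨κ, rfl⟩
    exact dualEnd_fiberPoint hc κ ω
  · rintro rfl
    exact ⟨kerPart hc ζ, fiberPoint_kerPart hc ζ⟩

theorem fiberSum_eq_sum [Fintype (DualKer α)] (hc : IsBorelCrossSection α c) {M : Type*}
    [AddCommMonoid M] (f : PontryaginDual Γ → M) (ω : PontryaginDual Γ) :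
    fiberSum α f ω = ∑ κ : DualKer α, f (fiberPoint c κ ω) := by
  have h : fiberSum α f ω = ∑ᶠ ζ ∈ {ζ | dualEnd α ζ = ω}, f ζ := rfl
  rw [h, ← range_fiberPoint hc ω, finsum_mem_range (fiberPoint_injective ω),
    finsum_eq_sum_of_fintype]

/-- Summing over a fibre is summing over the translates by the kernel. -/
theorem sum_fiberPoint_dualEnd [Fintype (DualKer α)] (hc : IsBorelCrossSection α c) {M : Type*}
    [AddCommMonoid M] (f : PontryaginDual Γ → M) (ω : PontryaginDual Γ) :
    ∑ κ : DualKer α, f (fiberPoint c κ (dualEnd α ω))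
      = ∑ κ : DualKer α, f ((κ : PontryaginDual Γ) * ω) := by
  -- Since `c(α^* ω) = τ(ω) ω`, the fibre point with index `κ` is the translate of `ω` by `κ⁻¹
  -- τ(ω)`.
  refine Fintype.sum_equiv ((Equiv.inv _).trans (Equiv.mulRight (kerPart hc ω))) _ _ fun κ => ?_
  congr 1
  simp [fiberPoint, kerPart, mul_assoc]

/-- Precomposing with `α^*` keeps the integral and turns the fibre sum into a sum over translates by
the `N` kernel elements, each with the same integral. -/
theorem lintegral_sum_fiberPoint [Fintype (DualKer α)] (hc : IsBorelCrossSection α c)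
    (hN : α.range.index ≠ 0) {f : PontryaginDual Γ → ℝ≥0∞} (hf : Measurable f) :
    ∫⁻ ω, ∑ κ : DualKer α, f (fiberPoint c κ ω) ∂(dualHaar Γ)
      = α.range.index * ∫⁻ ω, f ω ∂(dualHaar Γ) := by
  have hm : Measurable fun ω => ∑ κ : DualKer α, f (fiberPoint c κ ω) :=
    Finset.measurable_sum _ fun κ _ => hf.comp (measurable_fiberPoint hc κ)
  rw [← (measurePreserving_dualEnd hc.surjective).lintegral_comp hm]
  simp_rw [sum_fiberPoint_dualEnd hc f]
  rw [lintegral_finsetSum _ fun (κ : DualKer α) _ =>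
    show Measurable fun ω => f ((κ : PontryaginDual Γ) * ω) from hf.comp (measurable_const_mul _)]
  simp_rw [lintegral_mul_left_eq_self f]
  rw [Finset.sum_const, Finset.card_univ, ← Nat.card_eq_fintype_card, card_dualKer hN,
    nsmul_eq_mul]

theorem ae_fiberPoint [Finite (DualKer α)] (hc : IsBorelCrossSection α c)
    (hN : α.range.index ≠ 0) {p : PontryaginDual Γ → Prop} (hp : ∀ᵐ ω ∂(dualHaar Γ), p ω) :
    ∀ᵐ ω ∂(dualHaar Γ), ∀ κ : DualKer α, p (fiberPoint c κ ω) := by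
  have := Fintype.ofFinite (DualKer α)
  -- The fibre integral formula is applied to the indicator of a measurable null set containing the
  -- exceptional set, which need not itself be measurable.
  let Z := toMeasurable (dualHaar Γ) {ω | ¬ p ω}
  have hZ : MeasurableSet Z := measurableSet_toMeasurable _ _
  have hZ0 : dualHaar Γ Z = 0 := by rw [measure_toMeasurable]; exact hp
  have hm : Measurable (Z.indicator (1 : PontryaginDual Γ → ℝ≥0∞)) := measurable_one.indicator hZ
  have h := lintegral_sum_fiberPoint hc hN hm
  have hs : Measurable fun ω => ∑ κ : DualKer α,
      Z.indicator (1 : PontryaginDual Γ → ℝ≥0∞) (fiberPoint c κ ω) :=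
    Finset.measurable_sum _ fun κ _ => hm.comp (measurable_fiberPoint hc κ)
  rw [lintegral_indicator_one hZ, hZ0, mul_zero, lintegral_eq_zero_iff hs] at h
  filter_upwards [h] with ω hω κ
  by_contra hnp
  have h1 : fiberPoint c κ ω ∈ Z := subset_toMeasurable _ _ hnp
  have h2 := (Finset.sum_eq_zero_iff.1 hω) κ (Finset.mem_univ _)
  simp [h1] at h2

theorem ae_dualEnd (hc : IsBorelCrossSection α c) {p : PontryaginDual Γ → Prop}
    (hp : ∀ᵐ ω ∂(dualHaar Γ), p ω) : ∀ᵐ ω ∂(dualHaar Γ), p (dualEnd α ω) :=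
  (measurePreserving_dualEnd hc.surjective).quasiMeasurePreserving.ae hp

end Section

/-! ### Level sets -/

theorem measurable_sum_range {X M : Type*} [MeasurableSpace X] [MeasurableSpace M]
    [AddCommMonoid M] [MeasurableAdd₂ M] {n : X → ℕ} (hn : Measurable n) {f : ℕ → X → M}
    (hf : ∀ i, Measurable (f i)) : Measurable fun ω => ∑ i ∈ Finset.range (n ω), f i ω := by
  have h : Measurable fun p : X × ℕ => ∑ i ∈ Finset.range p.2, f i p.1 :=
    measurable_from_prod_countable_left fun k =>
      Finset.measurable_sum (Finset.range k) fun i _ => hf i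
  exact h.comp (measurable_id.prodMk hn)

omit [DiscreteTopology Γ] in
theorem measurableSet_levelSet {m : PontryaginDual Γ → ℕ} (hm : Measurable m) (i : ℕ) :
    MeasurableSet (levelSet m i) :=
  hm (measurableSet_Ici (a := i + 1))

/-- With indices starting at `0`, `ω` lies in the level set of `i` exactly when `i < m ω`; the rest
is Tonelli. -/
theorem tsum_lintegral_levelSet {m : PontryaginDual Γ → ℕ} (hm : Measurable m)
    {f : ℕ → PontryaginDual Γ → ℝ≥0∞} (hf : ∀ i, Measurable (f i)) :
    ∑' i, ∫⁻ ω, f i ω ∂(dualHaar Γ).restrict (levelSet m i)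
      = ∫⁻ ω, ∑ i ∈ Finset.range (m ω), f i ω ∂(dualHaar Γ) := by
  simp_rw [← lintegral_indicator (measurableSet_levelSet hm _)]
  rw [← lintegral_tsum fun i => ((hf i).indicator (measurableSet_levelSet hm i)).aemeasurable]
  refine lintegral_congr fun ω => ?_
  rw [tsum_eq_sum (s := Finset.range (m ω))]
  · refine Finset.sum_congr rfl fun i hi => Set.indicator_of_mem ?_ _
    exact Finset.mem_range.1 hi
  · intro i hi
    refine Set.indicator_of_notMem (fun h => hi ?_) _
    exact Finset.mem_range.2 h

theorem measurable_mTilde {α : Γ →* Γ} {c : PontryaginDual Γ → PontryaginDual Γ}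
    (hc : IsBorelCrossSection α c) [Finite (DualKer α)]
    {m : PontryaginDual Γ → ℕ} (hm : Measurable m) : Measurable (mTilde α m) := by
  have := Fintype.ofFinite (DualKer α)
  have h : mTilde α m = fun ω => ∑ κ : DualKer α, m (fiberPoint c κ ω) - m ω := by
    funext ω
    rw [mTilde, fiberSum_eq_sum hc]
  rw [h]
  exact (Finset.measurable_sum _ fun κ _ => hm.comp (measurable_fiberPoint hc κ)).sub hm

end Dual

/-! ### Square matrices with orthogonal rows -/

section Matrix

open Matrix

variable {A B : Type*} [Fintype A] [Fintype B] [DecidableEq A] [DecidableEq B]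

/-- A one-sided inverse of a square matrix is two-sided. This is the source of the surjectivity of
`T`. -/
theorem conjTranspose_mul_self_eq_of_mul_conjTranspose (hcard : Fintype.card A = Fintype.card B)
    {M : Matrix A B ℂ} {z : ℂ} (hz : z ≠ 0) (h : M * Mᴴ = z • (1 : Matrix A A ℂ)) :
    Mᴴ * M = z • (1 : Matrix B B ℂ) := by
  have h1 : M * (z⁻¹ • Mᴴ) = 1 := by
    rw [Matrix.mul_smul, h, smul_smul, inv_mul_cancel₀ hz, one_smul]
  have h2 := (Matrix.mul_eq_one_comm_of_card_eq _ _ _ hcard).1 h1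
  rw [Matrix.smul_mul] at h2
  rw [← h2, smul_smul, mul_inv_cancel₀ hz, one_smul]

omit [DecidableEq B] in
theorem sum_norm_sq_of_mul_conjTranspose {M : Matrix A B ℂ} {r : ℝ}
    (h : M * Mᴴ = (r : ℂ) • (1 : Matrix A A ℂ)) (v : A → ℂ) :
    ∑ b, ‖∑ a, M a b * v a‖ ^ 2 = r * ∑ a, ‖v a‖ ^ 2 := by
  have h1 : (v ᵥ* M) ⬝ᵥ star (v ᵥ* M) = r * (v ⬝ᵥ star v) := by
    rw [star_vecMul, dotProduct_mulVec, vecMul_vecMul, h, vecMul_smul, vecMul_one,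
      smul_dotProduct, smul_eq_mul]
  have h2 : ∀ b, (v ᵥ* M) b = ∑ a, M a b * v a := fun b =>
    Finset.sum_congr rfl fun a _ => mul_comm _ _
  simp only [dotProduct, Pi.star_apply, RCLike.star_def, Complex.mul_conj', h2] at h1
  exact_mod_cast h1

end Matrix

/-- The transpose of `Mᴴ M = z`, applied to the vector `F`. -/
theorem sum_mul_sum_conj_mul_of_conjTranspose_mul {A B : Type*} [Fintype A] [Fintype B]
    [DecidableEq B] {M : Matrix A B ℂ} {z : ℂ}
    (h : M.conjTranspose * M = z • (1 : Matrix B B ℂ)) (F : B → ℂ) (b₀ : B) :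
    ∑ a, M a b₀ * ∑ b, conj (M a b) * F b = z * F b₀ := by
  have h1 : ∀ b, ∑ a, conj (M a b) * M a b₀ = if b = b₀ then z else 0 := fun b => by
    have h2 := congrFun (congrFun h b) b₀
    rw [Matrix.smul_apply, Matrix.one_apply, smul_ite, smul_zero, smul_eq_mul, mul_one] at h2
    exact h2
  calc ∑ a, M a b₀ * ∑ b, conj (M a b) * F b
      = ∑ b, (∑ a, conj (M a b) * M a b₀) * F b := by
        simp_rw [Finset.mul_sum, Finset.sum_mul]
        rw [Finset.sum_comm]
        exact Finset.sum_congr rfl fun b _ => Finset.sum_congr rfl fun a _ => by ring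
    _ = z * F b₀ := by
        simp_rw [h1]
        simp

/-- A word is empty or has a first letter: the summands of `𝒲₀` are split off from those of the
dilates `𝒲ₙ₊₁ = 𝒟 𝒲ₙ`. -/
theorem tsum_prod_list {K : Type*} [Fintype K] (φ : ℕ × List K → ℝ≥0∞) :
    ∑' p, φ p = ∑' k, φ (k, []) + ∑' p : ℕ × List K, ∑ κ, φ (p.1, κ :: p.2) := by
  let e : ℕ ⊕ ((ℕ × List K) × K) ≃ ℕ × List K :=
    { toFun := Sum.elim (fun k => (k, [])) fun q => (q.1.1, q.2 :: q.1.2)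
      invFun := fun p => match p with
        | (k, []) => Sum.inl k
        | (k, κ :: l) => Sum.inr ((k, l), κ)
      left_inv := by rintro (k | ⟨⟨k, l⟩, κ⟩) <;> rfl
      right_inv := by rintro ⟨k, _ | ⟨κ, l⟩⟩ <;> rfl }
  rw [← e.tsum_eq, Summable.tsum_sum ENNReal.summable ENNReal.summable]
  congr 1
  rw [ENNReal.tsum_prod']
  exact tsum_congr fun p => tsum_fintype _

section Operator

universe u

variable {Γ : Type u} [CommGroup Γ] [TopologicalSpace Γ] [DiscreteTopology Γ]
  {α : Γ →* Γ} {c : PontryaginDual Γ → PontryaginDual Γ} {m : PontryaginDual Γ → ℕ}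
  {H G : ℕ → ℕ → PontryaginDual Γ → ℂ}

/-! ### The filter matrix on a fibre -/

/-- Puts the left sides of the filter equations in the form of finite matrix products. Vanishing of
one factor off the level sets suffices. -/
theorem ae_fiberSum_tsum_eq [Fintype (DualKer α)] (hc : IsBorelCrossSection α c)
    (hN : α.range.index ≠ 0) {F : ℕ → PontryaginDual Γ → ℂ} (F' : ℕ → PontryaginDual Γ → ℂ)
    (hF : ∀ j, ∀ᵐ ω ∂(dualHaar Γ), ω ∉ levelSet m j → F j ω = 0) :
    ∀ᵐ ω ∂(dualHaar Γ), fiberSum α (fun ζ => ∑' j, F j ζ * conj (F' j ζ)) ω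
      = ∑ κ : DualKer α, ∑ j ∈ Finset.range (m (fiberPoint c κ ω)),
        F j (fiberPoint c κ ω) * conj (F' j (fiberPoint c κ ω)) := by
  filter_upwards [ae_fiberPoint hc hN (ae_all_iff.2 hF)] with ω hω
  rw [fiberSum_eq_sum hc]
  refine Finset.sum_congr rfl fun κ _ => tsum_eq_sum fun j hj => ?_
  rw [hω κ j fun h => hj (Finset.mem_range.2 h), zero_mul]

/-- The rows of `H` and `G` on the fibre over `ω`. -/
noncomputable def fiberMatrix (α : Γ →* Γ) (c : PontryaginDual Γ → PontryaginDual Γ)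
    (m : PontryaginDual Γ → ℕ) (H G : ℕ → ℕ → PontryaginDual Γ → ℂ) (ω : PontryaginDual Γ) :
    Matrix (Fin (m ω) ⊕ Fin (mTilde α m ω))
      (Σ κ : DualKer α, Fin (m (fiberPoint c κ ω))) ℂ :=
  fun a b => Sum.elim (fun i : Fin (m ω) => H i b.2 (fiberPoint c b.1 ω))
    (fun k : Fin (mTilde α m ω) => G k b.2 (fiberPoint c b.1 ω)) a

/-- The four blocks are the filter equation of `H`, the orthogonality relation and its conjugate,
and the filter equation of `G`. The indicators equal `N` because only rows below `m ω` and `m̃ ω`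
are kept. -/
theorem ae_fiberMatrix_mul_conjTranspose [Fintype (DualKer α)] (hc : IsBorelCrossSection α c)
    (hN : α.range.index ≠ 0) (hH : IsFilterRel α m H) (hG : IsComplementaryFilter α m H G) :
    ∀ᵐ ω ∂(dualHaar Γ), fiberMatrix α c m H G ω * (fiberMatrix α c m H G ω).conjTranspose
      = (α.range.index : ℂ) • 1 := by
  have e1 := ae_all_iff.2 fun i => ae_all_iff.2 fun i' =>
    ae_fiberSum_tsum_eq hc hN (H i') (hH.support i)
  have e2 := ae_all_iff.2 fun k => ae_all_iff.2 fun k' =>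
    ae_fiberSum_tsum_eq hc hN (G k') (hG.support k)
  have e3 := ae_all_iff.2 fun k => ae_all_iff.2 fun i =>
    ae_fiberSum_tsum_eq hc hN (H i) (hG.support k)
  filter_upwards [e1, e2, e3, ae_all_iff.2 fun i => ae_all_iff.2 fun i' => hH.filter_eq i i',
    ae_all_iff.2 fun i => ae_all_iff.2 fun i' => hG.filter_eq i i',
    ae_all_iff.2 fun i => ae_all_iff.2 fun i' => hG.orthogonal i i'] with ω e1 e2 e3 h1 h2 h3
  have hoff : ∀ k i, ∑ κ : DualKer α, ∑ j ∈ Finset.range (m (fiberPoint c κ ω)),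
        G k j (fiberPoint c κ ω) * conj (H i j (fiberPoint c κ ω)) = 0 := fun k i => by
    rw [← e3, h3]
  ext a a'
  simp only [Matrix.mul_apply, Matrix.conjTranspose_apply, Fintype.sum_sigma,
    Matrix.smul_apply, Matrix.one_apply, smul_eq_mul, mul_ite, mul_zero, mul_one,
    RCLike.star_def]
  rcases a with i | k <;> rcases a' with i' | k'
  · have h := (e1 i i').symm.trans (h1 i i')
    simp only [Finset.sum_range] at h
    simp only [fiberMatrix, Sum.elim_inl, h, Sum.inl.injEq, Fin.ext_iff]
    rw [Set.indicator_of_mem (show ω ∈ levelSet m i from i.2)]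
  · have h := congrArg (starRingEnd ℂ) (hoff k' i)
    simp only [Finset.sum_range, map_sum, map_mul, Complex.conj_conj, map_zero] at h
    simp only [fiberMatrix, Sum.elim_inl, Sum.elim_inr, reduceCtorEq, if_false]
    rw [← h]
    exact Finset.sum_congr rfl fun κ _ => Finset.sum_congr rfl fun j _ => mul_comm _ _
  · have h := hoff k i'
    simp only [Finset.sum_range] at h
    simp only [fiberMatrix, Sum.elim_inl, Sum.elim_inr, reduceCtorEq, if_false, h]
  · have h := (e2 k k').symm.trans (h2 k k')
    simp only [Finset.sum_range] at h
    simp only [fiberMatrix, Sum.elim_inr, h, Sum.inr.injEq, Fin.ext_iff]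
    rw [Set.indicator_of_mem (show ω ∈ levelSet (mTilde α m) k from k.2)]

/-- By the consistency inequality the subtraction in `mTilde` does not truncate, so the matrix is
square. -/
theorem card_fiberMatrix_rows_eq [Fintype (DualKer α)] (hc : IsBorelCrossSection α c)
    {ω : PontryaginDual Γ} (h : m ω ≤ fiberSum α m ω) :
    Fintype.card (Fin (m ω) ⊕ Fin (mTilde α m ω))
      = Fintype.card (Σ κ : DualKer α, Fin (m (fiberPoint c κ ω))) := by
  rw [Fintype.card_sum, Fintype.card_sigma]
  simp only [Fintype.card_fin]
  rw [mTilde, Nat.add_sub_cancel' h, fiberSum_eq_sum hc]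

/-- Almost everywhere, the entries of a filter vanish off the level sets over the fibre. -/
theorem ae_filter_eq_zero [Fintype (DualKer α)] (hc : IsBorelCrossSection α c)
    (hN : α.range.index ≠ 0) {n : PontryaginDual Γ → ℕ} {F : ℕ → ℕ → PontryaginDual Γ → ℂ}
    (hs : ∀ i j, ∀ᵐ ω ∂(dualHaar Γ), ω ∉ levelSet m j → F i j ω = 0)
    (hF : ∀ i i', ∀ᵐ ω ∂(dualHaar Γ),
      fiberSum α (fun ζ => ∑' j, F i j ζ * conj (F i' j ζ)) ω
        = if i = i' then (levelSet n i).indicator (fun _ => (α.range.index : ℂ)) ω else 0) :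
    ∀ᵐ ω ∂(dualHaar Γ), ∀ i, n (dualEnd α ω) ≤ i → ∀ j, F i j ω = 0 := by
  have h : ∀ᵐ ω ∂(dualHaar Γ), ∀ i, n ω ≤ i → ∀ κ : DualKer α,
      ∀ j < m (fiberPoint c κ ω), F i j (fiberPoint c κ ω) = 0 := by
    filter_upwards [ae_all_iff.2 fun i => ae_fiberSum_tsum_eq hc hN (F i) (hs i),
      ae_all_iff.2 fun i => hF i i] with ω h1 h2 i hi κ j hj
    have h3 := (h1 i).symm.trans (h2 i)
    -- For `i ≥ n ω` the right side of the diagonal equation is `0`, while its left side is a sum of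
    -- squared moduli.
    rw [if_pos rfl, Set.indicator_of_notMem
      (show ω ∉ levelSet n i from fun h : i + 1 ≤ n ω => absurd h (by omega))] at h3
    simp_rw [Complex.mul_conj'] at h3
    have h4 : ∑ κ : DualKer α, ∑ j ∈ Finset.range (m (fiberPoint c κ ω)),
        ‖F i j (fiberPoint c κ ω)‖ ^ 2 = 0 := by exact_mod_cast h3
    rw [Finset.sum_eq_zero_iff_of_nonneg fun κ _ => Finset.sum_nonneg fun j _ => by positivity]
      at h4
    have h5 := h4 κ (Finset.mem_univ _)
    rw [Finset.sum_eq_zero_iff_of_nonneg fun j _ => by positivity] at h5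
    simpa using h5 j (Finset.mem_range.2 hj)
  filter_upwards [ae_dualEnd hc h, ae_all_iff.2 fun i => ae_all_iff.2 fun j => hs i j]
    with ω h1 h2 i hi j
  by_cases hj : j < m ω
  · have h3 := h1 i hi (kerPart hc ω) j
    rw [fiberPoint_kerPart] at h3
    exact h3 hj
  · exact h2 i j hj

/-- The series in `ruelle` also reads `f i` off its level set, where a representative is arbitrary.
Those terms vanish because the matrix entries do. -/
theorem ae_ruelle_eq_sum_range [Fintype (DualKer α)] (hc : IsBorelCrossSection α c)
    (hN : α.range.index ≠ 0) {n : PontryaginDual Γ → ℕ} {F : ℕ → ℕ → PontryaginDual Γ → ℂ}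
    (hs : ∀ i j, ∀ᵐ ω ∂(dualHaar Γ), ω ∉ levelSet m j → F i j ω = 0)
    (hF : ∀ i i', ∀ᵐ ω ∂(dualHaar Γ),
      fiberSum α (fun ζ => ∑' j, F i j ζ * conj (F i' j ζ)) ω
        = if i = i' then (levelSet n i).indicator (fun _ => (α.range.index : ℂ)) ω else 0)
    (f : ℕ → PontryaginDual Γ → ℂ) (j : ℕ) :
    ∀ᵐ ω ∂(dualHaar Γ), ruelle α F f j ω
      = ∑ i ∈ Finset.range (n (dualEnd α ω)), F i j ω * f i (dualEnd α ω) := by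
  filter_upwards [ae_filter_eq_zero hc hN hs hF] with ω hω
  refine tsum_eq_sum fun i hi => ?_
  rw [hω i (by simpa using hi) j, zero_mul]

/-! ### The inverse dilation -/

theorem sum_indicator_tauSet [Fintype (DualKer α)] (hc : IsBorelCrossSection α c) {M : Type*}
    [AddCommMonoid M] (g : DualKer α → PontryaginDual Γ → M) (ω : PontryaginDual Γ) :
    ∑ κ, (tauSet α c κ).indicator (g κ) ω = g (kerPart hc ω) ω := by
  rw [Finset.sum_eq_single (kerPart hc ω)]
  · exact Set.indicator_of_mem ((mem_tauSet_iff hc _ _).2 rfl) _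
  · intro κ _ hκ
    exact Set.indicator_of_notMem (fun h => hκ ((mem_tauSet_iff hc _ _).1 h).symm) _
  · intro h
    exact absurd (Finset.mem_univ _) h

theorem lintegral_wMeasure_cons [Countable Γ] (hc : IsBorelCrossSection α c) (k : ℕ)
    (κ : DualKer α) (l : List (DualKer α)) {g : PontryaginDual Γ → ℝ≥0∞} (hg : Measurable g) :
    ∫⁻ ω, g ω ∂wMeasure α c m k (κ :: l)
      = ∫⁻ ω, (tauSet α c κ).indicator (fun ω => α.range.index * g (dualEnd α ω)) ω
        ∂wMeasure α c m k l := by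
  rw [wMeasure, lintegral_smul_measure, lintegral_map hg (measurable_dualEnd α),
    lintegral_indicator (measurableSet_tauSet hc κ),
    lintegral_const_mul _ (show Measurable fun ω => g (dualEnd α ω) from
      hg.comp (measurable_dualEnd α)), smul_eq_mul]

variable [Fintype (DualKer α)]

/-- The pointwise formula for the inverse dilation `T`. -/
noncomputable def invDilation (α : Γ →* Γ) (c : PontryaginDual Γ → PontryaginDual Γ)
    (m : PontryaginDual Γ → ℕ) (H G : ℕ → ℕ → PontryaginDual Γ → ℂ) [Fintype (DualKer α)] :
    (ℕ ⊕ (ℕ × List (DualKer α)) → PontryaginDual Γ → ℂ) →ₗ[ℂ]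
      (ℕ ⊕ (ℕ × List (DualKer α)) → PontryaginDual Γ → ℂ) where
  toFun f := Sum.elim
    (fun j ω => ∑ i ∈ Finset.range (m (dualEnd α ω)), H i j ω * f (Sum.inl i) (dualEnd α ω)
      + ∑ k ∈ Finset.range (mTilde α m (dualEnd α ω)),
        G k j ω * f (Sum.inr (k, [])) (dualEnd α ω))
    (fun p ω => ∑ κ : DualKer α, (tauSet α c κ).indicator (fun ω =>
      (Real.sqrt (α.range.index : ℝ) : ℂ) * f (Sum.inr (p.1, κ :: p.2)) (dualEnd α ω)) ω)
  map_add' f g := by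
    funext a ω
    rcases a with j | p
    · simp only [Sum.elim_inl, Pi.add_apply, mul_add, Finset.sum_add_distrib]
      ring
    · simp only [Sum.elim_inr, Pi.add_apply, mul_add, ← Finset.sum_add_distrib]
      exact Finset.sum_congr rfl fun κ _ => congrFun (Set.indicator_add' _ _ _) ω
  map_smul' z f := by
    funext a ω
    rcases a with j | p
    · simp only [Sum.elim_inl, Pi.smul_apply, smul_eq_mul, RingHom.id_apply, mul_add,
        Finset.mul_sum]
      congr 1 <;> exact Finset.sum_congr rfl fun _ _ => by ring
    · simp only [Sum.elim_inr, Pi.smul_apply, smul_eq_mul, RingHom.id_apply, Finset.mul_sum]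
      refine Finset.sum_congr rfl fun κ _ => ?_
      by_cases h : ω ∈ tauSet α c κ
      · simp only [Set.indicator_of_mem h]
        ring
      · simp only [Set.indicator_of_notMem h, mul_zero]

theorem invDilation_inl (f : ℕ ⊕ (ℕ × List (DualKer α)) → PontryaginDual Γ → ℂ) (j : ℕ)
    (ω : PontryaginDual Γ) :
    invDilation α c m H G f (Sum.inl j) ω
      = ∑ i ∈ Finset.range (m (dualEnd α ω)), H i j ω * f (Sum.inl i) (dualEnd α ω)
        + ∑ k ∈ Finset.range (mTilde α m (dualEnd α ω)),
          G k j ω * f (Sum.inr (k, [])) (dualEnd α ω) := rfl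

/-- The sets `{τ = κ}` partition the dual group, so exactly one term of the sum survives. -/
theorem invDilation_inr (hc : IsBorelCrossSection α c)
    (f : ℕ ⊕ (ℕ × List (DualKer α)) → PontryaginDual Γ → ℂ) (p : ℕ × List (DualKer α))
    (ω : PontryaginDual Γ) :
    invDilation α c m H G f (Sum.inr p) ω = (Real.sqrt (α.range.index : ℝ) : ℂ) *
      f (Sum.inr (p.1, kerPart hc ω :: p.2)) (dualEnd α ω) :=
  sum_indicator_tauSet hc (fun κ ω =>
    (Real.sqrt (α.range.index : ℝ) : ℂ) * f (Sum.inr (p.1, κ :: p.2)) (dualEnd α ω)) ω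

theorem measurable_invDilation [Countable Γ] (hc : IsBorelCrossSection α c) (hm : Measurable m)
    (hH : ∀ i j, Measurable (H i j)) (hG : ∀ i j, Measurable (G i j))
    (f : ℕ ⊕ (ℕ × List (DualKer α)) → PontryaginDual Γ → ℂ) (hf : ∀ a, Measurable (f a))
    (b : ℕ ⊕ (ℕ × List (DualKer α))) : Measurable (invDilation α c m H G f b) := by
  have hα := measurable_dualEnd α
  rcases b with j | p
  · exact (measurable_sum_range (hm.comp hα) fun i => (hH i j).mul ((hf _).comp hα)).add
      (measurable_sum_range ((measurable_mTilde hc hm).comp hα) fun i =>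
        (hG i j).mul ((hf _).comp hα))
  · exact Finset.measurable_sum _ fun κ _ =>
      (((hf _).comp hα).const_mul _).indicator (measurableSet_tauSet hc κ)

omit [Fintype (DualKer α)] in
theorem l2Energy_canonicalMeasure
    (f : ℕ ⊕ (ℕ × List (DualKer α)) → PontryaginDual Γ → ℂ) :
    l2Energy (canonicalMeasure α c m) f
      = ∑' i, ∫⁻ ω, ‖f (Sum.inl i) ω‖ₑ ^ 2 ∂(dualHaar Γ).restrict (levelSet m i)
        + ∑' p : ℕ × List (DualKer α), ∫⁻ ω, ‖f (Sum.inr p) ω‖ₑ ^ 2 ∂wMeasure α c m p.1 p.2 :=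
  Summable.tsum_sum ENNReal.summable ENNReal.summable

omit [TopologicalSpace Γ] [DiscreteTopology Γ] [Fintype (DualKer α)] in
theorem enorm_sqrt_index_sq : ‖(Real.sqrt (α.range.index : ℝ) : ℂ)‖ₑ ^ 2 = α.range.index := by
  rw [← ofReal_norm, ← ENNReal.ofReal_pow (norm_nonneg _), Complex.norm_real, Real.norm_eq_abs,
    sq_abs, Real.sq_sqrt (Nat.cast_nonneg _), ENNReal.ofReal_natCast]

omit [TopologicalSpace Γ] [DiscreteTopology Γ] [Fintype (DualKer α)] in
theorem sqrt_index_ne_zero (hN : α.range.index ≠ 0) :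
    (Real.sqrt (α.range.index : ℝ) : ℂ) ≠ 0 := by
  rw [Complex.ofReal_ne_zero, Real.sqrt_ne_zero (Nat.cast_nonneg _)]
  exact_mod_cast hN

/-- Isometry of `𝒟⁻¹`: the factor `N` in the dilated measure is the square of the factor `√N` in the
formula, and the pieces `{τ = κ}` add up to the whole space. -/
theorem sum_lintegral_wMeasure_cons [Countable Γ] (hc : IsBorelCrossSection α c)
    {f : ℕ ⊕ (ℕ × List (DualKer α)) → PontryaginDual Γ → ℂ} (hf : ∀ a, Measurable (f a))
    (p : ℕ × List (DualKer α)) :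
    ∑ κ, ∫⁻ ω, ‖f (Sum.inr (p.1, κ :: p.2)) ω‖ₑ ^ 2 ∂wMeasure α c m p.1 (κ :: p.2)
      = ∫⁻ ω, ‖invDilation α c m H G f (Sum.inr p) ω‖ₑ ^ 2 ∂wMeasure α c m p.1 p.2 := by
  have hg : ∀ κ, Measurable fun ω => ‖f (Sum.inr (p.1, κ :: p.2)) ω‖ₑ ^ 2 := fun κ =>
    (hf _).enorm.pow_const 2
  simp_rw [lintegral_wMeasure_cons hc p.1 _ p.2 (hg _)]
  have hi : ∀ κ, Measurable ((tauSet α c κ).indicator fun ω =>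
      (α.range.index : ℝ≥0∞) * ‖f (Sum.inr (p.1, κ :: p.2)) (dualEnd α ω)‖ₑ ^ 2) := fun κ =>
    (((hg κ).comp (measurable_dualEnd α)).const_mul _).indicator (measurableSet_tauSet hc κ)
  rw [← lintegral_finsetSum _ fun κ _ => hi κ]
  refine lintegral_congr fun ω => ?_
  rw [sum_indicator_tauSet hc (fun κ ω =>
    (α.range.index : ℝ≥0∞) * ‖f (Sum.inr (p.1, κ :: p.2)) (dualEnd α ω)‖ₑ ^ 2), invDilation_inr hc,
    enorm_mul, mul_pow, enorm_sqrt_index_sq]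

/-- On the fibre over `ω` the `𝒱₀` components of the image form the row vector of the values of `f`
in `𝒱₀ ⊕ 𝒲₀` at `ω`, multiplied by the fibre matrix. -/
theorem ae_sum_enorm_sq_invDilation (hc : IsBorelCrossSection α c)
    (hN : α.range.index ≠ 0) (hH : IsFilterRel α m H) (hG : IsComplementaryFilter α m H G)
    (f : ℕ ⊕ (ℕ × List (DualKer α)) → PontryaginDual Γ → ℂ) :
    ∀ᵐ ω ∂(dualHaar Γ), ∑ κ : DualKer α, ∑ j ∈ Finset.range (m (fiberPoint c κ ω)),
        ‖invDilation α c m H G f (Sum.inl j) (fiberPoint c κ ω)‖ₑ ^ 2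
      = α.range.index * (∑ i ∈ Finset.range (m ω), ‖f (Sum.inl i) ω‖ₑ ^ 2
        + ∑ k ∈ Finset.range (mTilde α m ω), ‖f (Sum.inr (k, [])) ω‖ₑ ^ 2) := by
  filter_upwards [ae_fiberMatrix_mul_conjTranspose hc hN hH hG] with ω hω
  have h := sum_norm_sq_of_mul_conjTranspose (r := α.range.index)
    (by rw [hω, Complex.ofReal_natCast])
    (Sum.elim (fun i : Fin (m ω) => f (Sum.inl i) ω) fun k : Fin (mTilde α m ω) => f (Sum.inr (k, [])) ω)
  simp only [Fintype.sum_sum_type, Fintype.sum_sigma, fiberMatrix, Sum.elim_inl,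
    Sum.elim_inr] at h
  have h2 := congrArg ENNReal.ofReal h
  rw [ENNReal.ofReal_mul (Nat.cast_nonneg _), ENNReal.ofReal_natCast,
    ENNReal.ofReal_add (Finset.sum_nonneg fun _ _ => by positivity)
      (Finset.sum_nonneg fun _ _ => by positivity),
    ENNReal.ofReal_sum_of_nonneg (fun _ _ => Finset.sum_nonneg fun _ _ => by positivity),
    ENNReal.ofReal_sum_of_nonneg (fun _ _ => by positivity),
    ENNReal.ofReal_sum_of_nonneg (fun _ _ => by positivity)] at h2
  simp_rw [ENNReal.ofReal_sum_of_nonneg (fun (_ : Fin _) _ => sq_nonneg (‖_‖ : ℝ)),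
    ENNReal.ofReal_pow (norm_nonneg _), ofReal_norm] at h2
  simp_rw [invDilation_inl, dualEnd_fiberPoint hc, Finset.sum_range]
  exact h2

theorem l2Energy_invDilation [Countable Γ] (hc : IsBorelCrossSection α c)
    (hN : α.range.index ≠ 0) (hm : Measurable m) (hH : IsFilterRel α m H)
    (hG : IsComplementaryFilter α m H G)
    (f : ℕ ⊕ (ℕ × List (DualKer α)) → PontryaginDual Γ → ℂ) (hf : ∀ a, Measurable (f a)) :
    l2Energy (canonicalMeasure α c m) (invDilation α c m H G f)
      = l2Energy (canonicalMeasure α c m) f := by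
  have hP := measurable_invDilation hc hm hH.measurable hG.measurable f hf
  have hP2 : ∀ j, Measurable fun ω => ‖invDilation α c m H G f (Sum.inl j) ω‖ₑ ^ 2 := fun j =>
    (hP _).enorm.pow_const 2
  have hf2 : ∀ a, Measurable fun ω => ‖f a ω‖ₑ ^ 2 := fun a => (hf _).enorm.pow_const 2
  have hm' := measurable_mTilde hc hm
  -- The nonempty words account for the `𝒲` part of the image; what remains is to compare its `𝒱₀`
  -- part with `𝒱₀ ⊕ 𝒲₀`.
  rw [l2Energy_canonicalMeasure, l2Energy_canonicalMeasure, tsum_prod_list (fun p =>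
    ∫⁻ ω, ‖f (Sum.inr p) ω‖ₑ ^ 2 ∂wMeasure α c m p.1 p.2), ← add_assoc]
  simp_rw [sum_lintegral_wMeasure_cons (H := H) (G := G) hc hf]
  congr 1
  rw [tsum_lintegral_levelSet hm hP2, tsum_lintegral_levelSet hm fun i => hf2 _]
  have hw : ∑' k, ∫⁻ ω, ‖f (Sum.inr (k, [])) ω‖ₑ ^ 2 ∂wMeasure α c m k []
      = ∫⁻ ω, ∑ k ∈ Finset.range (mTilde α m ω), ‖f (Sum.inr (k, [])) ω‖ₑ ^ 2 ∂dualHaar Γ :=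
    tsum_lintegral_levelSet hm' fun k => hf2 (Sum.inr (k, []))
  rw [hw, ← lintegral_add_left (measurable_sum_range hm fun i => hf2 _)]
  have hs : Measurable fun ω => ∑ i ∈ Finset.range (m ω), ‖f (Sum.inl i) ω‖ₑ ^ 2
      + ∑ k ∈ Finset.range (mTilde α m ω), ‖f (Sum.inr (k, [])) ω‖ₑ ^ 2 :=
    (measurable_sum_range hm fun i => hf2 _).add
      (measurable_sum_range hm' fun k => hf2 (Sum.inr (k, [])))
  have hN' : (α.range.index : ℝ≥0∞) ≠ 0 := by exact_mod_cast hN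
  -- After multiplication by `N` the integral of the image becomes an integral of fibre sums, which
  -- can be compared fibre by fibre.
  refine (ENNReal.mul_right_inj hN' (ENNReal.natCast_ne_top _)).1 ?_
  rw [← lintegral_sum_fiberPoint hc hN (measurable_sum_range hm hP2),
    ← lintegral_const_mul _ hs]
  exact lintegral_congr_ae (ae_sum_enorm_sq_invDilation hc hN hH hG f)

/-! ### The pointwise inverse -/

/-- The pointwise formula for the adjoint of a Ruelle operator. -/
noncomputable def ruelleAdjoint (α : Γ →* Γ) (c : PontryaginDual Γ → PontryaginDual Γ)
    (m : PontryaginDual Γ → ℕ) [Fintype (DualKer α)] (F : ℕ → ℕ → PontryaginDual Γ → ℂ)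
    (f : ℕ → PontryaginDual Γ → ℂ) (i : ℕ) (ω : PontryaginDual Γ) : ℂ :=
  (α.range.index : ℂ)⁻¹ * ∑ κ : DualKer α, ∑ j ∈ Finset.range (m (fiberPoint c κ ω)),
    conj (F i j (fiberPoint c κ ω)) * f j (fiberPoint c κ ω)

theorem measurable_ruelleAdjoint (hc : IsBorelCrossSection α c) (hm : Measurable m)
    {F : ℕ → ℕ → PontryaginDual Γ → ℂ} (hF : ∀ i j, Measurable (F i j))
    {f : ℕ → PontryaginDual Γ → ℂ} (hf : ∀ j, Measurable (f j)) (i : ℕ) :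
    Measurable (ruelleAdjoint α c m F f i) := by
  refine Measurable.const_mul (Finset.measurable_sum _ fun κ _ => ?_) _
  have hκ := measurable_fiberPoint hc κ
  exact measurable_sum_range (hm.comp hκ) fun j =>
    (Complex.continuous_conj.measurable.comp ((hF i j).comp hκ)).mul ((hf j).comp hκ)

/-- The pointwise formula for the dilation. -/
noncomputable def forwardDilation (α : Γ →* Γ) (c : PontryaginDual Γ → PontryaginDual Γ)
    (m : PontryaginDual Γ → ℕ) (H G : ℕ → ℕ → PontryaginDual Γ → ℂ) [Fintype (DualKer α)]
    (f : ℕ ⊕ (ℕ × List (DualKer α)) → PontryaginDual Γ → ℂ) :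
    ℕ ⊕ (ℕ × List (DualKer α)) → PontryaginDual Γ → ℂ
  | Sum.inl i => ruelleAdjoint α c m H (fun j => f (Sum.inl j)) i
  | Sum.inr (k, []) => ruelleAdjoint α c m G (fun j => f (Sum.inl j)) k
  | Sum.inr (k, κ :: l) => dilate α c (f (Sum.inr (k, l))) κ

theorem measurable_forwardDilation (hc : IsBorelCrossSection α c) (hm : Measurable m)
    (hH : ∀ i j, Measurable (H i j)) (hG : ∀ i j, Measurable (G i j))
    {f : ℕ ⊕ (ℕ × List (DualKer α)) → PontryaginDual Γ → ℂ} (hf : ∀ a, Measurable (f a)) :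
    ∀ a, Measurable (forwardDilation α c m H G f a)
  | Sum.inl i => measurable_ruelleAdjoint hc hm hH (fun _ => hf _) i
  | Sum.inr (k, []) => measurable_ruelleAdjoint hc hm hG (fun _ => hf _) k
  | Sum.inr (_, κ :: _) => ((hf _).comp (measurable_fiberPoint hc κ)).const_mul _

/-- The pointwise form of `S_H S_H^* + S_G S_G^* = 1`, which is the column relation `Mᴴ M = N` of
the fibre matrix. -/
theorem ae_sum_mul_ruelleAdjoint (hc : IsBorelCrossSection α c)
    (hN : α.range.index ≠ 0) (hm : IsMultiplicityFunction α m) (hH : IsFilterRel α m H)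
    (hG : IsComplementaryFilter α m H G) (f : ℕ → PontryaginDual Γ → ℂ) :
    ∀ᵐ ω ∂(dualHaar Γ), ∀ κ : DualKer α, ∀ j < m (fiberPoint c κ ω),
      ∑ i ∈ Finset.range (m ω), H i j (fiberPoint c κ ω) * ruelleAdjoint α c m H f i ω
        + ∑ k ∈ Finset.range (mTilde α m ω),
          G k j (fiberPoint c κ ω) * ruelleAdjoint α c m G f k ω = f j (fiberPoint c κ ω) := by
  classical
  have hN' : (α.range.index : ℂ) ≠ 0 := by exact_mod_cast hN
  filter_upwards [ae_fiberMatrix_mul_conjTranspose hc hN hH hG, hm.consistency]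
    with ω hω hcons κ j hj
  have h1 := conjTranspose_mul_self_eq_of_mul_conjTranspose
    (card_fiberMatrix_rows_eq hc hcons) hN' hω
  have h2 := sum_mul_sum_conj_mul_of_conjTranspose_mul h1
    (fun b => f b.2 (fiberPoint c b.1 ω)) ⟨κ, ⟨j, hj⟩⟩
  simp only [Fintype.sum_sum_type, Fintype.sum_sigma, fiberMatrix, Sum.elim_inl,
    Sum.elim_inr] at h2
  simp only [ruelleAdjoint, Finset.sum_range, mul_left_comm _ (α.range.index : ℂ)⁻¹,
    ← Finset.mul_sum]
  simp only [Finset.mul_sum] at h2 ⊢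
  rw [← mul_right_inj' hN', ← h2, mul_add]
  simp only [Finset.mul_sum, mul_inv_cancel_left₀ hN']

theorem ae_invDilation_forwardDilation [Countable Γ] (hc : IsBorelCrossSection α c)
    (hN : α.range.index ≠ 0) (hm : IsMultiplicityFunction α m) (hH : IsFilterRel α m H)
    (hG : IsComplementaryFilter α m H G)
    (f : ℕ ⊕ (ℕ × List (DualKer α)) → PontryaginDual Γ → ℂ) (b) :
    invDilation α c m H G (forwardDilation α c m H G f) b =ᵐ[canonicalMeasure α c m b] f b := by
  rcases b with j | p
  · refine (ae_restrict_iff' (measurableSet_levelSet hm.measurable j)).2 ?_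
    filter_upwards [ae_dualEnd hc (ae_sum_mul_ruelleAdjoint hc hN hm hH hG
      fun j => f (Sum.inl j))] with ω hω hj
    have h := hω (kerPart hc ω) j
    rw [fiberPoint_kerPart] at h
    exact h hj
  · refine .of_forall fun ω => ?_
    have h := fiberPoint_kerPart hc ω
    rw [fiberPoint] at h
    rw [invDilation_inr hc, forwardDilation, dilate, h, one_div, mul_inv_cancel_left₀ (sqrt_index_ne_zero hN)]

theorem exists_invDilation_unitary [Countable Γ] (hc : IsBorelCrossSection α c)
    (hN : α.range.index ≠ 0) (hm : IsMultiplicityFunction α m) (hH : IsFilterRel α m H)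
    (hG : IsComplementaryFilter α m H G) :
    ∃ T : CanonicalSpace α c m ≃ₗᵢ[ℂ] CanonicalSpace α c m,
      ∀ (F : CanonicalSpace α c m) (f : ℕ ⊕ (ℕ × List (DualKer α)) → PontryaginDual Γ → ℂ),
        (∀ a, Measurable (f a)) → (∀ a, F a =ᵐ[canonicalMeasure α c m a] f a) →
        ∀ b, T F b =ᵐ[canonicalMeasure α c m b] invDilation α c m H G f b :=
  exists_unitary_of_l2Energy_preserving
    (measurable_invDilation hc hm.measurable hH.measurable hG.measurable)
    (l2Energy_invDilation hc hN hm.measurable hH hG) fun g hg =>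
      ⟨forwardDilation α c m H G g,
        measurable_forwardDilation hc hm.measurable hH.measurable hG.measurable hg,
        ae_invDilation_forwardDilation hc hN hm hH hG g⟩

end Operator

/-! ### Generalized multiresolution analyses from an isometry of the core space -/

section Abstract

variable {Γ : Type*} [CommGroup Γ] {α : Γ →* Γ} {C E F : Type*}
  [NormedAddCommGroup C] [InnerProductSpace ℂ C]
  [NormedAddCommGroup E] [InnerProductSpace ℂ E] [CompleteSpace E]
  [NormedAddCommGroup F] [InnerProductSpace ℂ F] [CompleteSpace F]

omit [CompleteSpace E] in
theorem map_zpow_add_one (δ : E ≃ₗᵢ[ℂ] E) (W : Submodule ℂ E) (j : ℤ) :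
    W.map ((δ ^ (j + 1) : E ≃ₗᵢ[ℂ] E) : E →ₗ[ℂ] E)
      = (W.map ((δ ^ j : E ≃ₗᵢ[ℂ] E) : E →ₗ[ℂ] E)).map (δ : E →ₗ[ℂ] E) := by
  rw [add_comm, zpow_add, zpow_one, ← Submodule.map_comp]
  rfl

omit [CompleteSpace E] in
theorem map_zpow_add_one' (δ : E ≃ₗᵢ[ℂ] E) (W : Submodule ℂ E) (j : ℤ) :
    W.map ((δ ^ (j + 1) : E ≃ₗᵢ[ℂ] E) : E →ₗ[ℂ] E)
      = (W.map (δ : E →ₗ[ℂ] E)).map ((δ ^ j : E ≃ₗᵢ[ℂ] E) : E →ₗ[ℂ] E) := by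
  rw [zpow_add, zpow_one, ← Submodule.map_comp]
  rfl

omit [CompleteSpace E] in
theorem map_le_map_symm {δ : E ≃ₗᵢ[ℂ] E} {ι : C →ₗᵢ[ℂ] E} {S : C →ₗᵢ[ℂ] C}
    (hS : ∀ g, δ.symm (ι g) = ι (S g)) :
    LinearMap.range ι.toLinearMap ≤ (LinearMap.range ι.toLinearMap).map (δ : E →ₗ[ℂ] E) := by
  rintro _ ⟨g, rfl⟩
  refine ⟨ι (S g), ⟨S g, rfl⟩, ?_⟩
  rw [← hS]
  exact δ.apply_symm_apply (ι g)

omit [CompleteSpace E] in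
theorem zpow_neg_natCast_apply_embedding {δ : E ≃ₗᵢ[ℂ] E} {ι : C →ₗᵢ[ℂ] E} {S : C →ₗᵢ[ℂ] C}
    (hS : ∀ g, δ.symm (ι g) = ι (S g)) (n : ℕ) (g : C) :
    (δ ^ (-(n : ℤ)) : E ≃ₗᵢ[ℂ] E) (ι g) = ι (S^[n] g) := by
  induction n generalizing g with
  | zero => rfl
  | succ n ih =>
    have h : (δ ^ (-((n + 1 : ℕ) : ℤ)) : E ≃ₗᵢ[ℂ] E) (ι g)
        = (δ ^ (-(n : ℤ)) : E ≃ₗᵢ[ℂ] E) (δ.symm (ι g)) := by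
      rw [Nat.cast_succ, neg_add, zpow_add, zpow_neg_one]
      rfl
    rw [h, hS, ih, Function.iterate_succ_apply]

/-- The generalized multiresolution analysis `V_j = δ^j V_0` of a unitary `δ` whose inverse
restricts to a pure isometry of `V_0`. -/
def GMRA.ofPureIsometry (hsep : SeparableSpace E) (π : Γ →* (E ≃ₗᵢ[ℂ] E)) (δ : E ≃ₗᵢ[ℂ] E)
    (hconj : ∀ (γ : Γ) (x : E), δ.symm (π γ (δ x)) = π (α γ) x)
    [CompleteSpace C] (ι : C →ₗᵢ[ℂ] E) (S : C →ₗᵢ[ℂ] C) (hS : ∀ g, δ.symm (ι g) = ι (S g))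
    (hpure : IsPureIsometry S) (W : Submodule ℂ E) (hW : W = LinearMap.range ι.toLinearMap)
    (hinv : ∀ γ, ∀ x ∈ W, π γ x ∈ W)
    (hdense : Dense (⋃ j : ℤ, (W.map ((δ ^ j : E ≃ₗᵢ[ℂ] E) : E →ₗ[ℂ] E) : Set E))) :
    GMRA α E where
  separable := hsep
  π := π
  δ := δ
  conj_eq := hconj
  V j := W.map ((δ ^ j : E ≃ₗᵢ[ℂ] E) : E →ₗ[ℂ] E)
  isClosed j := by
    have h : IsClosed (W : Set E) := by
      rw [hW]
      exact ι.isometry.isClosedEmbedding.isClosed_range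
    exact ((δ ^ j : E ≃ₗᵢ[ℂ] E).toHomeomorph.isClosedMap _ h)
  le_succ j := by
    rw [map_zpow_add_one', hW]
    exact Submodule.map_mono (map_le_map_symm hS)
  map_eq j := map_zpow_add_one δ W j
  iInf_eq := by
    refine (Submodule.eq_bot_iff _).2 fun x hx => ?_
    rw [Submodule.mem_iInf] at hx
    -- The levels `-n` suffice: `δ⁻ⁿ V₀` is the image under `ι` of the range of `Sⁿ`, and purity
    -- applies since `ι` is injective.
    have h : ∀ n : ℕ, ∃ g, ι (S^[n] g) = x := fun n => by
      obtain ⟨y, hy, hyx⟩ := hx (-(n : ℤ))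
      rw [hW] at hy
      obtain ⟨g, rfl⟩ := hy
      exact ⟨g, (zpow_neg_natCast_apply_embedding hS n g).symm.trans hyx⟩
    obtain ⟨g, hg⟩ := h 0
    have hmem : g ∈ ⋂ n : ℕ, Set.range (S^[n]) := by
      refine Set.mem_iInter.2 fun n => ?_
      obtain ⟨g', hg'⟩ := h n
      exact ⟨g', ι.injective (hg'.trans hg.symm)⟩
    rw [hpure] at hmem
    rw [← hg, Set.mem_singleton_iff.1 hmem]
    exact map_zero ι
  dense := hdense
  invariant γ x hx := by
    have h0 : W.map ((δ ^ (0 : ℤ) : E ≃ₗᵢ[ℂ] E) : E →ₗ[ℂ] E) = W := by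
      rw [zpow_zero]
      exact Submodule.map_id W
    rw [h0] at hx ⊢
    exact hinv γ x hx

theorem GMRA.ext_of_eq {X Y : GMRA α E} (hπ : X.π = Y.π) (hδ : X.δ = Y.δ) (hV : X.V = Y.V) :
    X = Y := by
  cases X
  cases Y
  cases hπ
  cases hδ
  cases hV
  rfl

/-! ### Equivalence of generalized multiresolution analyses with the same core -/

theorem GMRA.monotone (X : GMRA α E) : Monotone X.V :=
  monotone_int_of_le_succ X.le_succ

theorem GMRA.mem_V_natCast (X : GMRA α E) {ι : C →ₗᵢ[ℂ] E}
    (h0 : X.V 0 = LinearMap.range ι.toLinearMap) (n : ℕ) {x : E} :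
    x ∈ X.V n ↔ ∃ g, (X.δ ^ n : E ≃ₗᵢ[ℂ] E) (ι g) = x := by
  induction n generalizing x with
  | zero =>
    rw [Nat.cast_zero, h0]
    rfl
  | succ n ih =>
    rw [Nat.cast_succ, X.map_eq, pow_succ']
    constructor
    · rintro ⟨y, hy, rfl⟩
      obtain ⟨g, rfl⟩ := ih.1 hy
      exact ⟨g, rfl⟩
    · rintro ⟨g, rfl⟩
      exact ⟨_, ih.2 ⟨g, rfl⟩, rfl⟩

theorem GMRA.dense_range_pow (X : GMRA α E) {ι : C →ₗᵢ[ℂ] E}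
    (h0 : X.V 0 = LinearMap.range ι.toLinearMap) :
    Dense {x | ∃ (n : ℕ) (g : C), (X.δ ^ n : E ≃ₗᵢ[ℂ] E) (ι g) = x} := by
  refine X.dense.mono ?_
  rintro x hx
  obtain ⟨j, hj⟩ := Set.mem_iUnion.1 hx
  exact ⟨j.natAbs, (X.mem_V_natCast h0 _).1 (X.monotone (by omega) hj)⟩

theorem GMRA.π_pow_δ (X : GMRA α E) (n : ℕ) (γ : Γ) (x : E) :
    X.π γ ((X.δ ^ n : E ≃ₗᵢ[ℂ] E) x) = (X.δ ^ n : E ≃ₗᵢ[ℂ] E) (X.π (α^[n] γ) x) := by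
  induction n generalizing γ with
  | zero => rfl
  | succ n ih =>
    rw [pow_succ', LinearIsometryEquiv.coe_mul, Function.comp_apply, Function.comp_apply,
      Function.iterate_succ_apply, ← ih, ← X.conj_eq, LinearIsometryEquiv.apply_symm_apply]

omit [CompleteSpace E] in
-- Allows two vectors `δⁿ ι g` and `δᵏ ι g'` to be written with a common exponent, using data of the
-- core only.
theorem pow_add_apply_embedding {δ : E ≃ₗᵢ[ℂ] E} {ι : C →ₗᵢ[ℂ] E} {S : C →ₗᵢ[ℂ] C}
    (hS : ∀ g, δ.symm (ι g) = ι (S g)) (n k : ℕ) (g : C) :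
    (δ ^ (n + k) : E ≃ₗᵢ[ℂ] E) (ι (S^[k] g)) = (δ ^ n : E ≃ₗᵢ[ℂ] E) (ι g) := by
  have h : (δ ^ (n + k) : E ≃ₗᵢ[ℂ] E) * δ ^ (-(k : ℤ)) = δ ^ n := by
    rw [zpow_neg, zpow_natCast, pow_add, mul_inv_cancel_right]
  rw [← zpow_neg_natCast_apply_embedding hS, ← h]
  rfl

/-- Two generalized multiresolution analyses with unitarily equivalent cores, on which the
inverse dilations and the representations agree, are equivalent. -/
theorem GMRA.equivalent_of_core (X : GMRA α E) (Y : GMRA α F) (ι : C →ₗᵢ[ℂ] E)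
    (ι' : C →ₗᵢ[ℂ] F) (S : C →ₗᵢ[ℂ] C)
    (h0 : X.V 0 = LinearMap.range ι.toLinearMap) (h0' : Y.V 0 = LinearMap.range ι'.toLinearMap)
    (hS : ∀ g, X.δ.symm (ι g) = ι (S g)) (hS' : ∀ g, Y.δ.symm (ι' g) = ι' (S g))
    (hπ : ∀ γ g, ∃ h, X.π γ (ι g) = ι h ∧ Y.π γ (ι' g) = ι' h) : X.Equivalent Y := by
  -- The graph of `δⁿ ι g ↦ δ'ⁿ ι' g`. Working with a relation avoids checking separately that the
  -- map is well defined: equality of norms implies it.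
  let R : Submodule ℂ (E × F) :=
    { carrier := {p | ∃ (n : ℕ) (g : C),
        p = ((X.δ ^ n : E ≃ₗᵢ[ℂ] E) (ι g), (Y.δ ^ n : F ≃ₗᵢ[ℂ] F) (ι' g))}
      zero_mem' := ⟨0, 0, by simp only [map_zero]; rfl⟩
      add_mem' := by
        rintro _ _ ⟨n, g, rfl⟩ ⟨k, g', rfl⟩
        refine ⟨n + k, S^[k] g + S^[n] g', ?_⟩
        simp only [map_add, pow_add_apply_embedding hS, pow_add_apply_embedding hS']
        rw [add_comm n k, pow_add_apply_embedding hS, pow_add_apply_embedding hS']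
        rfl
      smul_mem' := by
        rintro z _ ⟨n, g, rfl⟩
        exact ⟨n, z • g, by simp⟩ }
  have hR : ∀ (n : ℕ) (g : C),
      ((X.δ ^ n : E ≃ₗᵢ[ℂ] E) (ι g), (Y.δ ^ n : F ≃ₗᵢ[ℂ] F) (ι' g)) ∈ R := fun n g => ⟨n, g, rfl⟩
  obtain ⟨U, hU⟩ := exists_unitary_of_norm_preserving_relation R
    (by rintro _ ⟨n, g, rfl⟩; simp)
    ((X.dense_range_pow h0).mono (by
      rintro _ ⟨n, g, rfl⟩
      exact ⟨_, hR n g, rfl⟩))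
    ((Y.dense_range_pow h0').mono (by
      rintro _ ⟨n, g, rfl⟩
      exact ⟨_, hR n g, rfl⟩))
  have hU' : ∀ (n : ℕ) (g : C),
      U ((X.δ ^ n : E ≃ₗᵢ[ℂ] E) (ι g)) = (Y.δ ^ n : F ≃ₗᵢ[ℂ] F) (ι' g) :=
    fun n g => hU _ (hR n g)
  have hUδ : ∀ x, U (X.δ x) = Y.δ (U x) := by
    refine congrFun (Continuous.ext_on (X.dense_range_pow h0)
      (U.continuous.comp X.δ.continuous) (Y.δ.continuous.comp U.continuous) ?_)
    rintro _ ⟨n, g, rfl⟩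
    have h := hU' (n + 1) g
    rw [pow_succ', pow_succ', LinearIsometryEquiv.coe_mul, LinearIsometryEquiv.coe_mul,
      Function.comp_apply, Function.comp_apply, ← hU'] at h
    exact h
  have hUπ : ∀ γ x, U (X.π γ x) = Y.π γ (U x) := by
    refine fun γ => congrFun (Continuous.ext_on (X.dense_range_pow h0)
      (U.continuous.comp (X.π γ).continuous) ((Y.π γ).continuous.comp U.continuous) ?_)
    rintro _ ⟨n, g, rfl⟩
    obtain ⟨h, h1, h2⟩ := hπ (α^[n] γ) g
    dsimp only [Function.comp_apply]
    rw [hU', X.π_pow_δ, Y.π_pow_δ, h1, h2, hU']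
  have hstep : ∀ j, ((X.V j).map (U : E →ₗ[ℂ] F)).map (Y.δ : F →ₗ[ℂ] F)
      = (X.V (j + 1)).map (U : E →ₗ[ℂ] F) := fun j => by
    rw [X.map_eq, ← Submodule.map_comp, ← Submodule.map_comp]
    congr 1
    exact LinearMap.ext fun x => (hUδ x).symm
  refine ⟨U, fun j => ?_, hUπ, hUδ⟩
  induction j using Int.induction_on with
  | zero =>
    rw [h0, h0']
    ext y
    constructor
    · rintro ⟨_, ⟨g, rfl⟩, rfl⟩
      exact ⟨g, (hU' 0 g).symm⟩
    · rintro ⟨g, rfl⟩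
      exact ⟨_, ⟨g, rfl⟩, hU' 0 g⟩
  | succ n ih => rw [← hstep, ih, ← Y.map_eq]
  | pred n ih =>
    -- For negative levels both sides are compared after applying the injective `δ'`.
    have h1 := hstep (-(n : ℤ) - 1)
    have h2 := Y.map_eq (-(n : ℤ) - 1)
    rw [sub_add_cancel] at h1 h2
    exact Submodule.map_injective_of_injective (f := (Y.δ : F →ₗ[ℂ] F)) Y.δ.injective
      (by rw [h1, ih, h2])

end Abstract

/-! ### The representation by characters -/

section Representation

universe u

variable {Γ : Type u} [CommGroup Γ] [TopologicalSpace Γ] [DiscreteTopology Γ]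

theorem measurable_eval (γ : Γ) : Measurable fun ω : PontryaginDual Γ => (ω γ : ℂ) := by
  have h : Topology.IsClosedEmbedding ((⇑) : (Γ →ₜ* Circle) → Γ → Circle) :=
    ContinuousMonoidHom.isClosedEmbedding_coe
  have h2 : Continuous fun ω : PontryaginDual Γ => ω γ :=
    (continuous_apply γ).comp h.continuous
  exact (continuous_subtype_val.comp h2).measurable

/-- Multiplication by a character, on families of functions. -/
noncomputable def charMul (I : Type*) (γ : Γ) :
    (I → PontryaginDual Γ → ℂ) →ₗ[ℂ] (I → PontryaginDual Γ → ℂ) where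
  toFun f a ω := (ω γ : ℂ) * f a ω
  map_add' f g := by
    funext a ω
    exact mul_add _ _ _
  map_smul' z f := by
    funext a ω
    exact mul_left_comm _ _ _

theorem exists_characterRepresentation {I : Type*} (ν : I → Measure (PontryaginDual Γ)) :
    ∃ π : Γ →* (lp (fun a => Lp ℂ 2 (ν a)) 2 ≃ₗᵢ[ℂ] lp (fun a => Lp ℂ 2 (ν a)) 2),
      ∀ γ f a, π γ f a =ᵐ[ν a] fun ω => (ω γ : ℂ) * f a ω := by
  have hmeas : ∀ γ (f : I → PontryaginDual Γ → ℂ), (∀ a, Measurable (f a)) →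
      ∀ a, Measurable (charMul I γ f a) := fun γ f hf a => (measurable_eval γ).mul (hf a)
  have h : ∀ γ : Γ, ∃ U : lp (fun a => Lp ℂ 2 (ν a)) 2 ≃ₗᵢ[ℂ] lp (fun a => Lp ℂ 2 (ν a)) 2,
      ∀ f a, U f a =ᵐ[ν a] fun ω => (ω γ : ℂ) * f a ω := fun γ => by
    obtain ⟨U, hU⟩ := exists_unitary_of_l2Energy_preserving (ν := ν) (ρ := ν)
      (P := charMul I γ) (hmeas γ)
      (fun f _ => tsum_congr fun a => lintegral_congr fun ω => by
        change ‖(ω γ : ℂ) * f a ω‖ₑ ^ 2 = _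
        rw [enorm_mul, ← ofReal_norm (ω γ : ℂ), Circle.norm_coe, ENNReal.ofReal_one, one_mul])
      (fun g hg => ⟨charMul I γ⁻¹ g, hmeas γ⁻¹ g hg, fun b => .of_forall fun ω => by
        change (ω γ : ℂ) * ((ω γ⁻¹ : ℂ) * g b ω) = g b ω
        rw [← mul_assoc, ← Circle.coe_mul, ← map_mul, mul_inv_cancel, map_one, Circle.coe_one,
          one_mul]⟩)
    exact ⟨U, fun f => hU f (fun a => f a) (measurable_coe_lp f) fun a => ae_eq_rfl⟩
  choose U hU using h
  refine ⟨MonoidHom.mk' U fun γ γ' => ?_, hU⟩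
  ext1 f
  refine lp_ext_ae fun a => ?_
  have h1 : (U γ * U γ') f = U γ (U γ' f) := rfl
  rw [h1]
  filter_upwards [hU (γ * γ') f a, hU γ (U γ' f) a, hU γ' f a] with ω h2 h3 h4
  rw [h2, h3, h4, map_mul, Circle.coe_mul, mul_assoc]

end Representation

/-! ### The canonical generalized multiresolution analysis -/

section Canonical

universe u

variable {Γ : Type u} [CommGroup Γ] [TopologicalSpace Γ] [DiscreteTopology Γ]
  {α : Γ →* Γ} {c : PontryaginDual Γ → PontryaginDual Γ} {m : PontryaginDual Γ → ℕ}
  {H G : ℕ → ℕ → PontryaginDual Γ → ℂ}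

theorem isFiniteMeasure_wMeasure (k : ℕ) (l : List (DualKer α)) :
    IsFiniteMeasure (wMeasure α c m k l) := by
  induction l with
  | nil => rw [wMeasure]; infer_instance
  | cons κ l ih =>
    rw [wMeasure]
    exact Measure.smul_finite _ (ENNReal.natCast_ne_top _)

theorem isFiniteMeasure_canonicalMeasure :
    ∀ a, IsFiniteMeasure (canonicalMeasure α c m a)
  | Sum.inl i => by rw [canonicalMeasure]; infer_instance
  | Sum.inr (k, l) => isFiniteMeasure_wMeasure k l

theorem separableSpace_canonicalSpace [Countable Γ] [Finite (DualKer α)] :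
    SeparableSpace (CanonicalSpace α c m) := by
  have := secondCountableTopology_dual (Γ := Γ)
  have := isFiniteMeasure_canonicalMeasure (α := α) (c := c) (m := m)
  have : Fact ((2 : ℝ≥0∞) ≠ ∞) := ⟨by norm_num⟩
  exact separableSpace_lp

theorem ae_wMeasure_cons_iff [Countable Γ] (hc : IsBorelCrossSection α c)
    (hN : α.range.index ≠ 0) (k : ℕ) (κ : DualKer α) (l : List (DualKer α))
    {p : PontryaginDual Γ → Prop} (hp : MeasurableSet {ω | p ω}) :
    (∀ᵐ ω ∂wMeasure α c m k (κ :: l), p ω)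
      ↔ ∀ᵐ ω ∂wMeasure α c m k l, ω ∈ tauSet α c κ → p (dualEnd α ω) := by
  have hN' : (α.range.index : ℝ≥0∞) ≠ 0 := by exact_mod_cast hN
  rw [wMeasure, Measure.ae_ennreal_smul_measure_iff hN',
    ae_map_iff (measurable_dualEnd α).aemeasurable hp,
    ae_restrict_iff' (measurableSet_tauSet hc κ)]

theorem dilate_dualEnd_of_mem_tauSet (hc : IsBorelCrossSection α c)
    (f : PontryaginDual Γ → ℂ) {κ : DualKer α} {ω : PontryaginDual Γ}
    (h : ω ∈ tauSet α c κ) : dilate α c f κ (dualEnd α ω)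
      = (1 / (Real.sqrt (α.range.index : ℝ) : ℂ)) * f ω := by
  have h1 := fiberPoint_of_mem_tauSet hc h
  rw [fiberPoint] at h1
  rw [dilate, h1]

theorem measurable_dilate (hc : IsBorelCrossSection α c) {f : PontryaginDual Γ → ℂ}
    (hf : Measurable f) (κ : DualKer α) : Measurable (dilate α c f κ) :=
  (hf.comp (measurable_fiberPoint hc κ)).const_mul _

/-- The conditions of `IsCanonicalGMRA` on the inverse dilation determine it. -/
theorem invDilation_unique [Countable Γ] [Finite (DualKer α)] (hc : IsBorelCrossSection α c)
    (hN : α.range.index ≠ 0) {T T' : CanonicalSpace α c m → CanonicalSpace α c m}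
    (h₁ : ∀ (f : CanonicalSpace α c m) (j : ℕ),
      T f (Sum.inl j) =ᵐ[canonicalMeasure α c m (Sum.inl j)] fun ω =>
        ruelle α H (fun i => f (Sum.inl i)) j ω + ruelle α G (fun k => f (Sum.inr (k, []))) j ω)
    (h₁' : ∀ (f : CanonicalSpace α c m) (j : ℕ),
      T' f (Sum.inl j) =ᵐ[canonicalMeasure α c m (Sum.inl j)] fun ω =>
        ruelle α H (fun i => f (Sum.inl i)) j ω + ruelle α G (fun k => f (Sum.inr (k, []))) j ω)
    (h₂ : ∀ (f : CanonicalSpace α c m) (k : ℕ) (l : List (DualKer α)) (κ : DualKer α),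
      f (Sum.inr (k, κ :: l)) =ᵐ[canonicalMeasure α c m (Sum.inr (k, κ :: l))]
        dilate α c (T f (Sum.inr (k, l))) κ)
    (h₂' : ∀ (f : CanonicalSpace α c m) (k : ℕ) (l : List (DualKer α)) (κ : DualKer α),
      f (Sum.inr (k, κ :: l)) =ᵐ[canonicalMeasure α c m (Sum.inr (k, κ :: l))]
        dilate α c (T' f (Sum.inr (k, l))) κ) : T = T' := by
  funext f
  refine lp_ext_ae fun a => ?_
  rcases a with j | ⟨k, l⟩
  · exact (h₁ f j).trans (h₁' f j).symm
  · have h : ∀ κ : DualKer α, ∀ᵐ ω ∂wMeasure α c m k l, ω ∈ tauSet α c κ →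
        dilate α c (T f (Sum.inr (k, l))) κ (dualEnd α ω)
          = dilate α c (T' f (Sum.inr (k, l))) κ (dualEnd α ω) := fun κ =>
      (ae_wMeasure_cons_iff hc hN k κ l (measurableSet_eq_fun
        (measurable_dilate hc (measurable_coe_lp (T f) _) κ)
        (measurable_dilate hc (measurable_coe_lp (T' f) _) κ))).1
        ((h₂ f k l κ).symm.trans (h₂' f k l κ))
    filter_upwards [ae_all_iff.2 h] with ω hω
    -- Every `ω` lies in the set `{τ = κ}` with `κ = τ(ω)`, and there the dilate at `α^* ω` recovers
    -- the value at `ω` up to a nonzero constant.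
    have hmem := (mem_tauSet_iff hc _ ω).2 rfl
    have h3 := hω _ hmem
    rw [dilate_dualEnd_of_mem_tauSet hc _ hmem, dilate_dualEnd_of_mem_tauSet hc _ hmem] at h3
    exact mul_left_cancel₀ (one_div_ne_zero (sqrt_index_ne_zero hN)) h3

/-- The core space depends on `m` alone, so it serves as the common piece of canonical spaces built
with different cross sections. -/
theorem exists_core_embedding (α : Γ →* Γ) (c : PontryaginDual Γ → PontryaginDual Γ)
    (m : PontryaginDual Γ → ℕ) :
    ∃ ι : CoreSpace m →ₗᵢ[ℂ] CanonicalSpace α c m,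
      (∀ g i, ι g (Sum.inl i) = g i) ∧ (∀ g p, ι g (Sum.inr p) = 0) ∧
      coreSubspace α c m = LinearMap.range ι.toLinearMap := by
  let P : (ℕ → PontryaginDual Γ → ℂ) →ₗ[ℂ]
      (ℕ ⊕ (ℕ × List (DualKer α)) → PontryaginDual Γ → ℂ) :=
    { toFun := fun f => Sum.elim f 0
      map_add' := fun f g => by
        funext a
        rcases a with i | p
        · rfl
        · exact (add_zero _).symm
      map_smul' := fun z f => by
        funext a
        rcases a with i | p
        · rfl
        · exact (smul_zero z).symm }
  obtain ⟨ι, hι⟩ := exists_isometry_of_l2Energy_preserving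
    (ν := fun i => (dualHaar Γ).restrict (levelSet m i)) (ρ := canonicalMeasure α c m) (P := P)
    (fun f hf b => by
      rcases b with i | p
      · exact hf i
      · exact measurable_const)
    (fun f _ => by
      rw [l2Energy_canonicalMeasure]
      simp [P, l2Energy])
  have h1 : ∀ g i, ι g (Sum.inl i) = g i := fun g i => Lp.ext
    (hι g (fun i => g i) (measurable_coe_lp g) (fun _ => ae_eq_rfl) (Sum.inl i))
  have h2 : ∀ g p, ι g (Sum.inr p) = 0 := fun g p => Lp.ext
    ((hι g (fun i => g i) (measurable_coe_lp g) (fun _ => ae_eq_rfl) (Sum.inr p)).trans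
      (Lp.coeFn_zero _ _ _).symm)
  refine ⟨ι, h1, h2, ?_⟩
  ext f
  constructor
  · intro hf
    obtain ⟨g, hg⟩ := exists_lp_of_l2Energy_ne_top
      (ν := fun i => (dualHaar Γ).restrict (levelSet m i)) (f := fun i => f (Sum.inl i))
      (fun i => measurable_coe_lp f _) (ne_top_of_le_ne_top (l2Energy_coe_ne_top f) (by
        rw [l2Energy_canonicalMeasure]
        exact le_self_add))
    refine ⟨g, lp.ext (funext fun a => ?_)⟩
    rcases a with i | p
    · exact (h1 g i).trans (Lp.ext (hg i))
    · exact (h2 g p).trans (hf p).symm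
  · rintro ⟨g, rfl⟩ p
    exact h2 g p

/-! ### Properties of the inverse dilation -/

section InverseDilation

variable [Fintype (DualKer α)] {T : CanonicalSpace α c m ≃ₗᵢ[ℂ] CanonicalSpace α c m}

/-- `T` is given by the pointwise formula for the inverse dilation. -/
def IsInvDilation (H G : ℕ → ℕ → PontryaginDual Γ → ℂ)
    (T : CanonicalSpace α c m ≃ₗᵢ[ℂ] CanonicalSpace α c m) : Prop :=
  ∀ (F : CanonicalSpace α c m) (f : ℕ ⊕ (ℕ × List (DualKer α)) → PontryaginDual Γ → ℂ),
    (∀ a, Measurable (f a)) → (∀ a, F a =ᵐ[canonicalMeasure α c m a] f a) →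
    ∀ b, T F b =ᵐ[canonicalMeasure α c m b] invDilation α c m H G f b

theorem IsInvDilation.coe_ae_eq (hT : IsInvDilation H G T) (F : CanonicalSpace α c m)
    (b : ℕ ⊕ (ℕ × List (DualKer α))) :
    T F b =ᵐ[canonicalMeasure α c m b] invDilation α c m H G (fun a => F a) b :=
  hT F (fun a => F a) (measurable_coe_lp F) (fun _ => ae_eq_rfl) b

theorem IsInvDilation.core_eq (hT : IsInvDilation H G T) (hc : IsBorelCrossSection α c)
    (hN : α.range.index ≠ 0) (hH : IsFilterRel α m H) (hG : IsComplementaryFilter α m H G)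
    (f : CanonicalSpace α c m) (j : ℕ) :
    T f (Sum.inl j) =ᵐ[canonicalMeasure α c m (Sum.inl j)] fun ω =>
      ruelle α H (fun i => f (Sum.inl i)) j ω + ruelle α G (fun k => f (Sum.inr (k, []))) j ω := by
  filter_upwards [hT.coe_ae_eq f (Sum.inl j),
    ae_restrict_of_ae (ae_ruelle_eq_sum_range hc hN hH.support hH.filter_eq
      (fun i => f (Sum.inl i)) j),
    ae_restrict_of_ae (ae_ruelle_eq_sum_range hc hN hG.support hG.filter_eq
      (fun k => f (Sum.inr (k, []))) j)] with ω h1 h2 h3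
  rw [h1, h2, h3, invDilation_inl]

theorem IsInvDilation.dilate_eq [Countable Γ] (hT : IsInvDilation H G T)
    (hc : IsBorelCrossSection α c) (hN : α.range.index ≠ 0)
    (f : CanonicalSpace α c m) (k : ℕ) (l : List (DualKer α)) (κ : DualKer α) :
    f (Sum.inr (k, κ :: l)) =ᵐ[canonicalMeasure α c m (Sum.inr (k, κ :: l))]
      dilate α c (T f (Sum.inr (k, l))) κ := by
  refine (ae_wMeasure_cons_iff hc hN k κ l (measurableSet_eq_fun (measurable_coe_lp f _)
    (measurable_dilate hc (measurable_coe_lp (T f) _) κ))).2 ?_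
  filter_upwards [hT.coe_ae_eq f (Sum.inr (k, l))] with ω h1 hω
  rw [dilate_dualEnd_of_mem_tauSet hc _ hω, h1, invDilation_inr hc,
    (mem_tauSet_iff hc κ ω).1 hω, one_div, inv_mul_cancel_left₀ (sqrt_index_ne_zero hN)]

/-- Every component of the image evaluates `f` at `α^* ω`, and `(α^* ω)(γ) = ω(α γ)`. -/
theorem IsInvDilation.comp_character (hT : IsInvDilation H G T) (hc : IsBorelCrossSection α c)
    {π : Γ →* (CanonicalSpace α c m ≃ₗᵢ[ℂ] CanonicalSpace α c m)}
    (hπ : ∀ γ f a, π γ f a =ᵐ[canonicalMeasure α c m a] fun ω => (ω γ : ℂ) * f a ω)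
    (γ : Γ) (f : CanonicalSpace α c m) : T (π γ f) = π (α γ) (T f) := by
  refine lp_ext_ae fun b => ?_
  filter_upwards [hT (π γ f) (charMul _ γ fun a => f a)
    (fun a => (measurable_eval γ).mul (measurable_coe_lp f a)) (hπ γ f) b,
    hπ (α γ) (T f) b, hT.coe_ae_eq f b] with ω h1 h2 h3
  rw [h1, h2, h3]
  rcases b with j | p
  · rw [invDilation_inl, invDilation_inl, mul_add, Finset.mul_sum, Finset.mul_sum]
    congr 1 <;> exact Finset.sum_congr rfl fun _ _ => mul_left_comm _ _ _
  · rw [invDilation_inr hc, invDilation_inr hc]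
    exact mul_left_comm _ _ _

/-- On `𝒱₀` the terms with `G` and all `𝒲` components vanish. No trace of `G` or `c` remains, which
is the reason for the equivalence. -/
theorem IsInvDilation.apply_embedding (hT : IsInvDilation H G T) (hc : IsBorelCrossSection α c)
    (hN : α.range.index ≠ 0) (hH : IsFilterRel α m H)
    {ι : CoreSpace m →ₗᵢ[ℂ] CanonicalSpace α c m} (hι : ∀ g i, ι g (Sum.inl i) = g i)
    (hι' : ∀ g p, ι g (Sum.inr p) = 0) {S : CoreSpace m →ₗᵢ[ℂ] CoreSpace m}
    (hS : ∀ (f : CoreSpace m) (j : ℕ),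
      S f j =ᵐ[(dualHaar Γ).restrict (levelSet m j)] ruelle α H (fun i => f i) j)
    (g : CoreSpace m) : T (ι g) = ι (S g) := by
  have h := hT (ι g) (Sum.elim (fun i => g i) 0)
    (by
      rintro (i | p)
      · exact measurable_coe_lp g i
      · exact measurable_const)
    (by
      rintro (i | p)
      · rw [hι]
        rfl
      · rw [hι']
        exact Lp.coeFn_zero _ _ _)
  refine lp_ext_ae fun b => (h b).trans ?_
  rcases b with j | p
  · rw [hι]
    filter_upwards [hS g j, ae_restrict_of_ae (ae_ruelle_eq_sum_range hc hN hH.support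
      hH.filter_eq (fun i => g i) j)] with ω h1 h2
    refine Eq.trans ?_ (h1.trans h2).symm
    rw [invDilation_inl]
    simp
  · rw [hι']
    filter_upwards [Lp.coeFn_zero ℂ 2 (canonicalMeasure α c m (Sum.inr p))] with ω h1
    rw [h1, invDilation_inr hc]
    simp

theorem IsInvDilation.apply_inr_eq_zero (hT : IsInvDilation H G T)
    (hc : IsBorelCrossSection α c) {n : ℕ} {f : CanonicalSpace α c m}
    (hf : ∀ k (l : List (DualKer α)), n + 1 ≤ l.length → f (Sum.inr (k, l)) = 0)
    (k : ℕ) (l : List (DualKer α)) (hl : n ≤ l.length) : T f (Sum.inr (k, l)) = 0 := by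
  classical
  -- A representative that is identically zero in the vanishing components makes the formula zero at
  -- every point, with no null sets to transport.
  have h := hT f (fun a => if f a = 0 then 0 else f a)
    (fun a => by
      dsimp only
      split_ifs
      · exact measurable_const
      · exact measurable_coe_lp f a)
    (fun a => by
      dsimp only
      split_ifs with h0
      · rw [h0]
        exact Lp.coeFn_zero _ _ _
      · exact ae_eq_rfl) (Sum.inr (k, l))
  refine Lp.ext (h.trans ?_)
  filter_upwards [Lp.coeFn_zero ℂ 2 (canonicalMeasure α c m (Sum.inr (k, l)))] with ω h1
  rw [h1, invDilation_inr hc]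
  dsimp only
  rw [if_pos (hf k _ (by simpa using hl))]
  simp

/-- Each application of `T` removes a letter from every word and sends the empty ones into `𝒱₀`;
after `n` steps no `𝒲` component is left. -/
theorem IsInvDilation.mem_map_pow (hT : IsInvDilation H G T) (hc : IsBorelCrossSection α c)
    (n : ℕ) {f : CanonicalSpace α c m}
    (hf : ∀ k (l : List (DualKer α)), n ≤ l.length → f (Sum.inr (k, l)) = 0) :
    f ∈ (coreSubspace α c m).map
      ((T.symm ^ (n : ℤ) : CanonicalSpace α c m ≃ₗᵢ[ℂ] CanonicalSpace α c m) :
        CanonicalSpace α c m →ₗ[ℂ] CanonicalSpace α c m) := by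
  induction n generalizing f with
  | zero => exact ⟨f, fun p => hf p.1 p.2 (Nat.zero_le _), rfl⟩
  | succ n ih =>
    rw [Nat.cast_succ, map_zpow_add_one]
    exact ⟨T f, ih (hT.apply_inr_eq_zero hc hf), T.symm_apply_apply f⟩

theorem IsInvDilation.dense_iUnion (hT : IsInvDilation H G T) (hc : IsBorelCrossSection α c) :
    Dense (⋃ j : ℤ, ((coreSubspace α c m).map
      ((T.symm ^ j : CanonicalSpace α c m ≃ₗᵢ[ℂ] CanonicalSpace α c m) :
        CanonicalSpace α c m →ₗ[ℂ] CanonicalSpace α c m) : Set (CanonicalSpace α c m))) := by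
  classical
  intro f
  refine mem_closure_of_tendsto (lp.hasSum_single (by norm_num) f) (.of_forall fun s => ?_)
  -- One more than the greatest word length in `s`, so that words of length at least `n` do not
  -- occur in the partial sum.
  let n := s.sup (Sum.elim (fun _ => 0) fun p => p.2.length + 1)
  refine Set.mem_iUnion.2 ⟨(n : ℤ), hT.mem_map_pow hc n fun k l hl => ?_⟩
  have hnot : Sum.inr (k, l) ∉ s := fun h => by
    have h1 : l.length + 1 ≤ n :=
      Finset.le_sup (f := Sum.elim (fun _ => 0) fun p => p.2.length + 1) h
    omega
  rw [lp.coeFn_sum, Finset.sum_apply]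
  exact Finset.sum_eq_zero fun a ha =>
    lp.single_apply_ne (E := fun a => Lp ℂ 2 (canonicalMeasure α c m a)) 2 a (f a)
      fun h : Sum.inr (k, l) = a => hnot (by rwa [h])

end InverseDilation

theorem exists_isCanonicalGMRA [Countable Γ] (hc : IsBorelCrossSection α c)
    (hN : α.range.index ≠ 0) (hm : IsMultiplicityFunction α m) (hH : IsFilterRel α m H)
    (hpure : RuelleIsPureIsometry α m H) (hG : IsComplementaryFilter α m H G) :
    ∃ X : GMRA α (CanonicalSpace α c m), IsCanonicalGMRA α c m H G X := by
  have := finite_dualKer hN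
  have := Fintype.ofFinite (DualKer α)
  obtain ⟨S, hS, hpure⟩ := hpure
  obtain ⟨T, hT⟩ := exists_invDilation_unitary hc hN hm hH hG
  replace hT : IsInvDilation H G T := hT
  obtain ⟨π, hπ⟩ := exists_characterRepresentation (canonicalMeasure α c m)
  obtain ⟨ι, hι, hι', hrange⟩ := exists_core_embedding α c m
  exact ⟨GMRA.ofPureIsometry separableSpace_canonicalSpace π T.symm
    (fun γ x => by
      rw [LinearIsometryEquiv.symm_symm, hT.comp_character hc hπ,
        LinearIsometryEquiv.apply_symm_apply])
    ι S (hT.apply_embedding hc hN hH hι hι' hS) hpure (coreSubspace α c m) hrange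
    (fun γ f hf p => by
      refine Lp.ext ?_
      filter_upwards [hπ γ f (Sum.inr p), Lp.coeFn_zero ℂ 2 (canonicalMeasure α c m (Sum.inr p))]
        with ω h1 h2
      rw [h1, hf p, h2]
      simp)
    (hT.dense_iUnion hc),
    ⟨hπ, hT.core_eq hc hN hH hG, hT.dilate_eq hc hN, fun _ => rfl⟩⟩

theorem IsCanonicalGMRA.unique [Countable Γ] (hc : IsBorelCrossSection α c)
    (hN : α.range.index ≠ 0) {X Y : GMRA α (CanonicalSpace α c m)}
    (hX : IsCanonicalGMRA α c m H G X) (hY : IsCanonicalGMRA α c m H G Y) : X = Y := by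
  have := finite_dualKer hN
  have hδ : X.δ = Y.δ := by
    have h := invDilation_unique hc hN hX.core_eq hY.core_eq hX.dilate_eq hY.dilate_eq
    refine LinearIsometryEquiv.ext fun f => ?_
    rw [← LinearIsometryEquiv.symm_apply_eq, ← congrFun h, LinearIsometryEquiv.symm_apply_apply]
  refine GMRA.ext_of_eq ?_ hδ ?_
  · refine MonoidHom.ext fun γ => LinearIsometryEquiv.ext fun f => lp_ext_ae fun a => ?_
    exact (hX.rep_eq γ f a).trans (hY.rep_eq γ f a).symm
  · funext j
    rw [hX.V_eq, hY.V_eq, hδ]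

/-- The defining conditions have a single solution, and the unitary constructed from the pointwise
formula is one; so its properties hold for every canonical GMRA. -/
theorem IsCanonicalGMRA.isInvDilation [Countable Γ] [Fintype (DualKer α)]
    (hc : IsBorelCrossSection α c) (hN : α.range.index ≠ 0) (hm : IsMultiplicityFunction α m)
    (hH : IsFilterRel α m H) (hG : IsComplementaryFilter α m H G)
    {X : GMRA α (CanonicalSpace α c m)} (hX : IsCanonicalGMRA α c m H G X) :
    IsInvDilation H G X.δ.symm := by
  obtain ⟨T, hT⟩ := exists_invDilation_unitary hc hN hm hH hG
  replace hT : IsInvDilation H G T := hT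
  have h := invDilation_unique hc hN hX.core_eq (hT.core_eq hc hN hH hG) hX.dilate_eq
    (hT.dilate_eq hc hN)
  rwa [show X.δ.symm = T from LinearIsometryEquiv.ext (congrFun h)]

theorem IsCanonicalGMRA.V_zero {X : GMRA α (CanonicalSpace α c m)}
    (hX : IsCanonicalGMRA α c m H G X) : X.V 0 = coreSubspace α c m := by
  rw [hX.V_eq, zpow_zero]
  exact Submodule.map_id _

theorem IsCanonicalGMRA.equivalent [Countable Γ] (hN : α.range.index ≠ 0)
    (hm : IsMultiplicityFunction α m) (hH : IsFilterRel α m H)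
    (hpure : RuelleIsPureIsometry α m H) {G' : ℕ → ℕ → PontryaginDual Γ → ℂ}
    (hG : IsComplementaryFilter α m H G) (hG' : IsComplementaryFilter α m H G')
    {c' : PontryaginDual Γ → PontryaginDual Γ} (hc : IsBorelCrossSection α c)
    (hc' : IsBorelCrossSection α c') {X : GMRA α (CanonicalSpace α c m)}
    {X' : GMRA α (CanonicalSpace α c' m)} (hX : IsCanonicalGMRA α c m H G X)
    (hX' : IsCanonicalGMRA α c' m H G' X') : X.Equivalent X' := by
  have := finite_dualKer hN
  have := Fintype.ofFinite (DualKer α)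
  obtain ⟨S, hS, -⟩ := hpure
  obtain ⟨ι, hι, hι₀, hrange⟩ := exists_core_embedding α c m
  obtain ⟨ι', hι', hι₀', hrange'⟩ := exists_core_embedding α c' m
  obtain ⟨π, hπ⟩ := exists_characterRepresentation
    (fun i => (dualHaar Γ).restrict (levelSet m i))
  have hT := hX.isInvDilation hc hN hm hH hG
  have hT' := hX'.isInvDilation hc' hN hm hH hG'
  -- Stated for an arbitrary cross section and filter, so that it applies to both GMRAs with the
  -- same `π` on the core.
  have hcore : ∀ {d : PontryaginDual Γ → PontryaginDual Γ} {K : ℕ → ℕ → PontryaginDual Γ → ℂ}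
      {Y : GMRA α (CanonicalSpace α d m)} {κ : CoreSpace m →ₗᵢ[ℂ] CanonicalSpace α d m},
      IsCanonicalGMRA α d m H K Y → (∀ g i, κ g (Sum.inl i) = g i) →
      (∀ g p, κ g (Sum.inr p) = 0) → ∀ γ g, Y.π γ (κ g) = κ (π γ g) := by
    intro d K Y κ hY h h₀ γ g
    refine lp_ext_ae fun a => (hY.rep_eq γ (κ g) a).trans ?_
    rcases a with i | p
    · rw [h, h]
      exact (hπ γ g i).symm
    · rw [h₀, h₀]
      filter_upwards [Lp.coeFn_zero ℂ 2 (canonicalMeasure α d m (Sum.inr p))] with ω h1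
      rw [h1]
      simp
  exact X.equivalent_of_core X' ι ι' S (hX.V_zero.trans hrange) (hX'.V_zero.trans hrange')
    (hT.apply_embedding hc hN hH hι hι₀ hS) (hT'.apply_embedding hc' hN hH hι' hι₀' hS)
    fun γ g => ⟨π γ g, hcore hX hι hι₀ γ g, hcore hX' hι' hι₀' γ g⟩

end Canonical

theorem mainTheorem7 {Γ : Type*} [CommGroup Γ] [Countable Γ] [TopologicalSpace Γ]
    [DiscreteTopology Γ]
    (α : Γ →* Γ) (hα : Function.Injective α) (hN : 1 < α.range.index)
    (hcap : (⋂ n : ℕ, Set.range (α^[n])) = {1})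
    (m : PontryaginDual Γ → ℕ) (hm : IsMultiplicityFunction α m)
    (H : ℕ → ℕ → PontryaginDual Γ → ℂ) (hH : IsFilterRel α m H)
    (hpure : RuelleIsPureIsometry α m H)
    (G G' : ℕ → ℕ → PontryaginDual Γ → ℂ)
    (hG : IsComplementaryFilter α m H G) (hG' : IsComplementaryFilter α m H G')
    (c c' : PontryaginDual Γ → PontryaginDual Γ)
    (hc : IsBorelCrossSection α c) (hc' : IsBorelCrossSection α c') :
    (∃! X : GMRA α (CanonicalSpace α c m), IsCanonicalGMRA α c m H G X) ∧
    (∃! X' : GMRA α (CanonicalSpace α c' m), IsCanonicalGMRA α c' m H G' X') ∧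
    ∀ (X : GMRA α (CanonicalSpace α c m)) (X' : GMRA α (CanonicalSpace α c' m)),
      IsCanonicalGMRA α c m H G X → IsCanonicalGMRA α c' m H G' X' → X.Equivalent X' := by
  have hN0 : α.range.index ≠ 0 := by omega
  obtain ⟨X, hX⟩ := exists_isCanonicalGMRA hc hN0 hm hH hpure hG
  obtain ⟨X', hX'⟩ := exists_isCanonicalGMRA hc' hN0 hm hH hpure hG'
  exact ⟨⟨X, hX, fun Y hY => hY.unique hc hN0 hX⟩, ⟨X', hX', fun Y hY => hY.unique hc' hN0 hX'⟩,
    fun Y Y' hY hY' => hY.equivalent hN0 hm hH hpure hG hG' hc hc' hY'⟩
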